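/- **Model.** All alphabets are finite and logarithms are to base $2$. For $k\in\{1,2\}$ put $\bar k=3-k$. A state-dependent discrete memoryless multiple access channel with feedback is given by a conditional law $P_{YZ_1Z_2|X_1X_2S}$ with input alphabets $\mathcal X_1,\mathcal X_2$, a joint law $P_{SS_{T_1}S_{T_2}S_R}$ of the channel state, the two sensing states and the state information at the receiver, and bounded distortion functions $d_k:\mathcal S_{T_k}\times\hat{\mathcal S}_{T_k}\to[0,\infty)$. The states $(S_i,S_{T_1,i},S_{T_2,i},S_{R,i})$ are i.i.d. in time and the channel is memoryless. A $(2^{nR_1},2^{nR_2},n)$ code consists of: independent messages $W_k$, uniform on $[1:2^{nR_k}]$ (the positive integers up to $2^{nR_k}$) and independent of the states; encoders $x_{k,i}=f_{k,i}(w_k,z_k^{i-1})$; a decoder $(\hat w_1,\hat w_2)=h(y^n,s_R^n)$; and estimators $\hat s_{T_k}^n=g_k(x_k^n,z_k^n)$. A tuple $(R_1,R_2,D_1,D_2)$ with $R_1,R_2\ge 0$ is achievable if there is a sequence of such codes with $\Pr\big((\hat W_1,\hat W_2)\ne(W_1,W_2)\big)\to0$ and $\limsup_{n\to\infty}\frac1n\sum_{i=1}^n\mathbb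 E[d_k(S_{T_k,i},\hat S_{T_k,i})]\le D_k$ for $k=1,2$. The capacity-distortion region $\mathcal C(D_1,D_2)$ is the closure of the set of $(R_1,R_2)$ such that $(R_1,R_2,D_1,D_2)$ is achievable. **Outer bound.** Let $\mathcal O^{\mathrm{our}}$ be the set of all $(R_1,R_2,D_1,D_2)$ with $R_1,R_2\ge0$ for which there are finite-valued random variables $Q,Q_Z$, with $T=(Q,Q_Z)$, and a joint law $P_{TX_1X_2}\,P_{SS_{T_1}S_{T_2}S_R}\,P_{YZ_1Z_2|X_1X_2S}$ (so that $Q - T - S_RX_1X_2 - YZ_1Z_2$ is a Markov chain) such that \begin{align*} R_1&\le I(X_1;YZ_1Z_2|S_RX_2T),\\ R_2&\le I(X_2;YZ_1Z_2|S_RX_1T),\\ R_1+R_2&\le I(X_1X_2;YZ_1Z_2|S_RT),\\ R_1+R_2&\le I(X_1X_2;Y|S_R),\\ I(X_1;X_2|T)&\le I(X_1;X_2|Z_1Z_2T),\\ f_{k,\mathrm{R\text{-}D}}(D_k)&\le I(S_{T_k}X_{\bar k};Z_k|X_kQ),\quad k\in\{1,2\},\\ f_{k,\mathrm{R\text{-}D}}(D_k)&\le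 I(S_{T_k};Z_1Z_2|X_1X_2Q),\quad k\in\{1,2\}, \end{align*} where $f_{k,\mathrm{R\text{-}D}}(D_k)$ is the minimum of $I(S_{T_k};\hat S_{T_k})$ over all conditional laws $P_{\hat S_{T_k}|X_kZ_kS_{T_k}}$ such that $\mathbb E[d_k(S_{T_k},\hat S_{T_k})]\le D_k$ under $P_{X_kZ_kS_{T_k}}P_{\hat S_{T_k}|X_kZ_kS_{T_k}}$ (and $+\infty$ if there is none). **Theorem.** For all $D_1,D_2$, every $(R_1,R_2)\in\mathcal C(D_1,D_2)$ satisfies $(R_1,R_2,D_1,D_2)\in\mathcal O^{\mathrm{our}}$. Moreover, $\mathcal O^{\mathrm{our}}$ does not change if the alphabets $\mathcal Q,\mathcal T$ of $Q,T$ are required to satisfy $|\mathcal Q|\le|\mathcal T|\le|\mathcal X_1||\mathcal X_2|+3$. -/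

import Mathlib

open Filter Topology

noncomputable section

namespace ISAC

/-! ### Shannon information measures on a finite outcome space, in bits -/

section Information

variable {Ω α β γ : Type*} [Fintype Ω] [Fintype α] [Fintype β] [Fintype γ]

open Classical in
/-- The law of the random variable `A` when outcomes are distributed according to `p`. -/
def law (p : Ω → ℝ) (A : Ω → α) (a : α) : ℝ := ∑ ω with A ω = a, p ω

/-- Entropy `H(A)`, with logarithms to base 2. -/
def entropy (p : Ω → ℝ) (A : Ω → α) : ℝ := (∑ a, Real.negMulLog (law p A a)) / Real.log 2

/-- Conditional entropy `H(A | C)`. -/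
def condEntropy (p : Ω → ℝ) (A : Ω → α) (C : Ω → γ) : ℝ :=
  entropy p (fun ω => (A ω, C ω)) - entropy p C

/-- Mutual information `I(A ; B)`. -/
def mutualInfo (p : Ω → ℝ) (A : Ω → α) (B : Ω → β) : ℝ :=
  entropy p A - condEntropy p A B

/-- Conditional mutual information `I(A ; B | C)`. -/
def condMutualInfo (p : Ω → ℝ) (A : Ω → α) (B : Ω → β) (C : Ω → γ) : ℝ :=
  condEntropy p A C - condEntropy p A (fun ω => (B ω, C ω))

end Information

/-! ### The rate-distortion function -/

section RateDistortion

variable {A B E F : Type*} [Fintype A] [Fintype B] [Fintype E] [Fintype F]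

/-- The law `P_{XZS} P_{Ŝ|XZS}` on `(x, z, s, ŝ)`. -/
def testLaw (P : A × B × E → ℝ) (κ : A × B × E → F → ℝ) : (A × B × E) × F → ℝ :=
  fun ω => P ω.1 * κ ω.1 ω.2

/-- The rate-distortion function: the minimum of `I(S ; Ŝ)` over all conditional laws
`P_{Ŝ|XZS}` with `E d(S, Ŝ) ≤ D`, where `P` is the law of `(X, Z, S)`. It is `⊤` when no
conditional law satisfies the distortion constraint. -/
def rateDistortion (d : E → F → ℝ) (P : A × B × E → ℝ) (D : ℝ) : EReal :=
  ⨅ (κ : A × B × E → F → ℝ) (_ : ∀ v, κ v ∈ stdSimplex ℝ F)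
    (_ : ∑ ω, testLaw P κ ω * d ω.1.2.2 ω.2 ≤ D),
    ((mutualInfo (testLaw P κ) (fun ω => ω.1.2.2) (fun ω => ω.2) : ℝ) : EReal)

end RateDistortion

/-! ### The channel model

The two transmitters are indexed by `k : Fin 2`; the other transmitter is `1 - k`. -/

/-- A state-dependent discrete memoryless multiple access channel with output feedback, together
with the state law and the two distortion functions. `X k`, `Z k`, `ST k`, `Sh k` are the input,
feedback, sensing-state and estimate alphabets of transmitter `k`; `S` is the channel state, `SR`
the state information of the receiver and `Y` the channel output. -/
structure Model (X Z ST Sh : Fin 2 → Type*) (S SR Y : Type*)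
    [∀ k, Fintype (X k)] [∀ k, Fintype (Z k)] [∀ k, Fintype (ST k)] [∀ k, Fintype (Sh k)]
    [Fintype S] [Fintype SR] [Fintype Y] where
  /-- The joint law of the states `(S, (S_{T_1}, S_{T_2}), S_R)`. -/
  stateLaw : S × (∀ k, ST k) × SR → ℝ
  stateLaw_mem : stateLaw ∈ stdSimplex ℝ (S × (∀ k, ST k) × SR)
  /-- The channel law of `(Y, (Z_1, Z_2))` given the inputs and the channel state. -/
  channel : (∀ k, X k) → S → Y × (∀ k, Z k) → ℝ
  channel_mem : ∀ x s, channel x s ∈ stdSimplex ℝ (Y × (∀ k, Z k))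
  /-- The distortion functions (automatically bounded, as the alphabets are finite). -/
  d : ∀ k, ST k → Sh k → ℝ
  d_nonneg : ∀ k s ŝ, 0 ≤ d k s ŝ

section Coding

variable {X Z ST Sh : Fin 2 → Type*} {S SR Y : Type*}
  [∀ k, Fintype (X k)] [∀ k, Fintype (Z k)] [∀ k, Fintype (ST k)] [∀ k, Fintype (Sh k)]
  [Fintype S] [Fintype SR] [Fintype Y]

/-- The size of the message set `[1 : 2^{nR}]`, the positive integers up to `2^{nR}`. -/
def numMessages (n : ℕ) (R : ℝ) : ℕ := ⌊(2 : ℝ) ^ ((n : ℝ) * R)⌋₊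

/-- A code of block length `n` with `N k` messages for transmitter `k`. -/
structure Code (X Z Sh : Fin 2 → Type*) (SR Y : Type*) (n : ℕ) (N : Fin 2 → ℕ) where
  /-- The symbol sent at time `i`, from the message and the feedback strictly before time `i`. -/
  enc : ∀ k, (i : Fin n) → Fin (N k) → (Fin i → Z k) → X k
  /-- The decoder of the receiver. -/
  dec : (Fin n → Y) → (Fin n → SR) → ∀ k, Fin (N k)
  /-- The state estimators. -/
  est : ∀ k, (Fin n → X k) → (Fin n → Z k) → Fin n → Sh k

/-- Outcomes of a transmission: the messages, the state sequences, the output sequences. -/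
abbrev Run (Z ST : Fin 2 → Type*) (S SR Y : Type*) (n : ℕ) (N : Fin 2 → ℕ) :=
  (∀ k, Fin (N k)) × (Fin n → S × (∀ k, ST k) × SR) × (Fin n → Y × (∀ k, Z k))

namespace Code

variable {n : ℕ} {N : Fin 2 → ℕ}

/-- The input sequence of transmitter `k`. -/
def input (c : Code X Z Sh SR Y n N) (ω : Run Z ST S SR Y n N) (k : Fin 2) (i : Fin n) : X k :=
  c.enc k i (ω.1 k) (fun j => (ω.2.2 (Fin.castLE i.is_lt.le j)).2 k)

/-- The probability of an outcome: uniform independent messages, i.i.d. states independent of the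
messages, memoryless channel. -/
def prob (c : Code X Z Sh SR Y n N) (M : Model X Z ST Sh S SR Y) (ω : Run Z ST S SR Y n N) : ℝ :=
  (∏ k, (1 / (N k : ℝ))) *
    ∏ i, M.stateLaw (ω.2.1 i) * M.channel (fun k => c.input ω k i) (ω.2.1 i).1 (ω.2.2 i)

open Classical in
/-- The probability that the decoded message pair differs from the message pair sent. -/
def errorProb (c : Code X Z Sh SR Y n N) (M : Model X Z ST Sh S SR Y) : ℝ :=
  ∑ ω : Run Z ST S SR Y n N with
    c.dec (fun i => (ω.2.2 i).1) (fun i => (ω.2.1 i).2.2) ≠ ω.1, c.prob M ω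

/-- The expected average distortion of estimator `k`. -/
def distortion (c : Code X Z Sh SR Y n N) (M : Model X Z ST Sh S SR Y) (k : Fin 2) : ℝ :=
  ∑ ω : Run Z ST S SR Y n N, c.prob M ω *
    ((1 / (n : ℝ)) * ∑ i, M.d k ((ω.2.1 i).2.1 k)
      (c.est k (c.input ω k) (fun j => (ω.2.2 j).2 k) i))

end Code

namespace Model

variable (M : Model X Z ST Sh S SR Y)

/-- Achievability of the rates `R` and distortions `D`. -/
def Achievable (R D : Fin 2 → ℝ) : Prop :=
  (∀ k, 0 ≤ R k) ∧
  ∃ c : ∀ n : ℕ, Code X Z Sh SR Y n (fun k => numMessages n (R k)),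
    Tendsto (fun n => (c n).errorProb M) atTop (𝓝 0) ∧
    ∀ k, limsup (fun n => (c n).distortion M k) atTop ≤ D k

/-- The capacity-distortion region `C(D_1, D_2)`. -/
def capacityRegion (D : Fin 2 → ℝ) : Set (Fin 2 → ℝ) :=
  closure {R | M.Achievable R D}

end Model

/-! ### The outer bound -/

section Outer

variable {𝒬 𝒬Z : Type*} [Fintype 𝒬] [Fintype 𝒬Z]

/-- Outcomes `((Q, Q_Z), X), (S, S_T, S_R), (Y, Z)` of the single-letter experiment. -/
abbrev Letter (𝒬 𝒬Z : Type*) (X Z ST : Fin 2 → Type*) (S SR Y : Type*) :=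
  ((𝒬 × 𝒬Z) × (∀ k, X k)) × (S × (∀ k, ST k) × SR) × (Y × (∀ k, Z k))

namespace Letter

/-- The random variable `Q`. -/
abbrev q (ω : Letter 𝒬 𝒬Z X Z ST S SR Y) : 𝒬 := ω.1.1.1
/-- The random variable `T = (Q, Q_Z)`. -/
abbrev t (ω : Letter 𝒬 𝒬Z X Z ST S SR Y) : 𝒬 × 𝒬Z := ω.1.1
/-- The channel inputs `(X_1, X_2)`. -/
abbrev x (ω : Letter 𝒬 𝒬Z X Z ST S SR Y) : ∀ k, X k := ω.1.2
/-- The sensing states `(S_{T_1}, S_{T_2})`. -/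
abbrev sT (ω : Letter 𝒬 𝒬Z X Z ST S SR Y) : ∀ k, ST k := ω.2.1.2.1
/-- The state information `S_R` of the receiver. -/
abbrev sR (ω : Letter 𝒬 𝒬Z X Z ST S SR Y) : SR := ω.2.1.2.2
/-- The channel output `Y`. -/
abbrev y (ω : Letter 𝒬 𝒬Z X Z ST S SR Y) : Y := ω.2.2.1
/-- The feedback outputs `(Z_1, Z_2)`. -/
abbrev z (ω : Letter 𝒬 𝒬Z X Z ST S SR Y) : ∀ k, Z k := ω.2.2.2

end Letter

namespace Model

variable (M : Model X Z ST Sh S SR Y)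

/-- The single-letter law `P_{T X_1 X_2} P_{S S_{T_1} S_{T_2} S_R} P_{Y Z_1 Z_2 | X_1 X_2 S}`. In
particular the states are independent of `(T, X_1, X_2)`, and
`Q - T - (S_R, X_1, X_2) - (Y, Z_1, Z_2)` is a Markov chain. -/
def letterLaw (P : (𝒬 × 𝒬Z) × (∀ k, X k) → ℝ) (ω : Letter 𝒬 𝒬Z X Z ST S SR Y) : ℝ :=
  P ω.1 * M.stateLaw ω.2.1 * M.channel ω.1.2 ω.2.1.1 ω.2.2

/-- The constraints of the outer bound on the rates `R` and distortions `D`, for the law `P` of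
`(T, X_1, X_2)`, where `T = (Q, Q_Z)`. -/
structure OuterConstraints (P : (𝒬 × 𝒬Z) × (∀ k, X k) → ℝ) (R D : Fin 2 → ℝ) : Prop where
  /-- `R_k ≤ I(X_k ; Y Z_1 Z_2 | S_R X_k̄ T)`. -/
  single_rate : ∀ k, R k ≤ condMutualInfo (M.letterLaw P)
    (fun ω => ω.x k) (fun ω => (ω.y, ω.z)) (fun ω => (ω.sR, ω.x (1 - k), ω.t))
  /-- `R_1 + R_2 ≤ I(X_1 X_2 ; Y Z_1 Z_2 | S_R T)`. -/
  sum_rate : R 0 + R 1 ≤ condMutualInfo (M.letterLaw P)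
    (fun ω => ω.x) (fun ω => (ω.y, ω.z)) (fun ω => (ω.sR, ω.t))
  /-- `R_1 + R_2 ≤ I(X_1 X_2 ; Y | S_R)`. -/
  cut_set : R 0 + R 1 ≤ condMutualInfo (M.letterLaw P)
    (fun ω => ω.x) (fun ω => ω.y) (fun ω => ω.sR)
  /-- `I(X_1 ; X_2 | T) ≤ I(X_1 ; X_2 | Z_1 Z_2 T)`. -/
  dependence_balance :
    condMutualInfo (M.letterLaw P) (fun ω => ω.x 0) (fun ω => ω.x 1) (fun ω => ω.t) ≤
    condMutualInfo (M.letterLaw P) (fun ω => ω.x 0) (fun ω => ω.x 1) (fun ω => (ω.z, ω.t))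
  /-- `f_k(D_k) ≤ I(S_{T_k} X_k̄ ; Z_k | X_k Q)`. -/
  sensing_own : ∀ k,
    rateDistortion (M.d k) (law (M.letterLaw P) (fun ω => (ω.x k, ω.z k, ω.sT k))) (D k) ≤
    ((condMutualInfo (M.letterLaw P)
      (fun ω => (ω.sT k, ω.x (1 - k))) (fun ω => ω.z k) (fun ω => (ω.x k, ω.q)) : ℝ) : EReal)
  /-- `f_k(D_k) ≤ I(S_{T_k} ; Z_1 Z_2 | X_1 X_2 Q)`. -/
  sensing_joint : ∀ k,
    rateDistortion (M.d k) (law (M.letterLaw P) (fun ω => (ω.x k, ω.z k, ω.sT k))) (D k) ≤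
    ((condMutualInfo (M.letterLaw P)
      (fun ω => ω.sT k) (fun ω => ω.z) (fun ω => (ω.x, ω.q)) : ℝ) : EReal)

/-- The outer bound: all `(R, D)` that satisfy the constraints for some law of `(T, X_1, X_2)`,
with arbitrary finite alphabets for `Q` and `Q_Z`. -/
def outerBound : Set ((Fin 2 → ℝ) × (Fin 2 → ℝ)) :=
  {RD | (∀ k, 0 ≤ RD.1 k) ∧ ∃ (a b : ℕ) (P : (Fin a × Fin b) × (∀ k, X k) → ℝ),
    P ∈ stdSimplex ℝ ((Fin a × Fin b) × (∀ k, X k)) ∧ M.OuterConstraints P RD.1 RD.2}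

/-- The outer bound with the alphabet sizes restricted to
`|𝒬| ≤ |𝒯| ≤ |𝒳_1| |𝒳_2| + 3`. -/
def outerBoundCard : Set ((Fin 2 → ℝ) × (Fin 2 → ℝ)) :=
  {RD | (∀ k, 0 ≤ RD.1 k) ∧ ∃ (a b : ℕ) (P : (Fin a × Fin b) × (∀ k, X k) → ℝ),
    Fintype.card (Fin a) ≤ Fintype.card (Fin a × Fin b) ∧
    Fintype.card (Fin a × Fin b) ≤ Fintype.card (X 0) * Fintype.card (X 1) + 3 ∧
    P ∈ stdSimplex ℝ ((Fin a × Fin b) × (∀ k, X k)) ∧ M.OuterConstraints P RD.1 RD.2}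

end Model

end Outer

end Coding

end ISAC

end

/-! The converse draws a time index uniformly and independently of a run of the code, and reads off
the inputs, states and outputs at that time. `Q_Z` is the time together with all earlier feedback,
and `Q` is constant. Given the messages and the past, the states and outputs at that time are drawn
from a kernel that depends on the inputs only (`timedProb_isTransition`), so the joint law has the
required single-letter form (`letterLaw_timedLaw`).

Each constraint is then an entropy computation. The rate bounds come from Fano's inequality and the
chain rule (`message_entropy_le`): the receiver's state information is fresh at every step, so only
output entropies remain. Dependence balance holds because the messages are independent beforehand
and have nonnegative conditional mutual information given the feedback (`dependence_balance_timed`).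
For sensing, the joint entropy of the states and the observations is expanded in two ways
(`sensing_info_le`), and the conditional law of the estimate at the random time is a test channel.

For the cardinality bound, the informations given `T` are sums over `t` of homogeneous functionals
of the slices `P (t, ·)`. A Carathéodory reduction (`exists_weights_card_support_le`) preserves the
input law and three rate functionals, that is |X_1||X_2| + 3 numbers, and does not decrease the
balance functional. All other quantities depend on the input law alone once `Q` is made constant,
which only increases the sensing bounds.

A code yields the constraints up to a slack that vanishes with the block length, on an alphabet that
grows with it. The cardinality bound moves everything to one fixed alphabet. There compactness and
continuity remove the slack (`exists_outerConstraints_of_approx`), which also covers the closure in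
the definition of the region. -/

noncomputable section

namespace ISAC

/-! ### Calculus of laws and entropies on a finite outcome space -/

section Information

variable {Ω α β γ δ ι : Type*}

/-- The random variable `B` is a function of the random variable `A`. -/
def Determines (A : Ω → α) (B : Ω → β) : Prop := ∀ ⦃ω ω'⦄, A ω = A ω' → B ω = B ω'

variable [Fintype Ω]

open Classical in
lemma law_eq_sum_ite (p : Ω → ℝ) (A : Ω → α) (a : α) :
    law p A a = ∑ ω, if A ω = a then p ω else 0 := by
  unfold law
  rw [Finset.sum_filter]

lemma law_nonneg {p : Ω → ℝ} (hp : ∀ ω, 0 ≤ p ω) (A : Ω → α) (a : α) : 0 ≤ law p A a :=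
  Finset.sum_nonneg fun ω _ => hp ω

lemma law_pos {p : Ω → ℝ} (hp : ∀ ω, 0 ≤ p ω) (A : Ω → α) {ω : Ω} (h : 0 < p ω) :
    0 < law p A (A ω) := by
  classical
  unfold law
  exact Finset.sum_pos' (fun ω _ => hp ω) ⟨ω, by simp, h⟩

lemma law_congr (p : Ω → ℝ) {A : Ω → α} {B : Ω → β} {a : α} {b : β}
    (h : ∀ ω, A ω = a ↔ B ω = b) : law p A a = law p B b := by
  classical
  simp only [law_eq_sum_ite, h]

lemma law_const_mul (c : ℝ) (p : Ω → ℝ) (A : Ω → α) (a : α) :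
    law (fun ω => c * p ω) A a = c * law p A a := by
  unfold law
  rw [Finset.mul_sum]

variable [Fintype α]

lemma sum_law_mul (p : Ω → ℝ) (A : Ω → α) (F : α → ℝ) :
    ∑ a, law p A a * F a = ∑ ω, p ω * F (A ω) := by
  classical
  simp only [law_eq_sum_ite, Finset.sum_mul, ite_mul, zero_mul]
  rw [Finset.sum_comm]
  simp

lemma sum_law (p : Ω → ℝ) (A : Ω → α) : ∑ a, law p A a = ∑ ω, p ω := by
  simpa using sum_law_mul p A (fun _ => 1)

lemma law_mem_stdSimplex {p : Ω → ℝ} (hp : p ∈ stdSimplex ℝ Ω) (A : Ω → α) :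
    law p A ∈ stdSimplex ℝ α :=
  ⟨law_nonneg hp.1 A, by rw [sum_law, hp.2]⟩

lemma law_law (p : Ω → ℝ) (A : Ω → α) (f : α → β) :
    law (law p A) f = law p (fun ω => f (A ω)) := by
  classical
  funext b
  rw [law_eq_sum_ite, law_eq_sum_ite]
  simpa using sum_law_mul p A (fun a => if f a = b then 1 else 0)

/-- The marginal of a joint law. -/
lemma sum_law_prod_left (p : Ω → ℝ) (A : Ω → α) (C : Ω → γ) (c : γ) :
    ∑ a, law p (fun ω => (A ω, C ω)) (a, c) = law p C c := by
  classical
  simp only [law_eq_sum_ite, Prod.mk.injEq, ite_and]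
  rw [Finset.sum_comm]
  simp

variable [Fintype β] [Fintype γ] [Fintype δ] [Fintype ι]

/-- As an expectation over outcomes, entropy refers to the values of `A` only through the events
they define; invariance under relabelling follows. -/
lemma entropy_eq_sum (p : Ω → ℝ) (A : Ω → α) :
    entropy p A = (∑ ω, p ω * -Real.log (law p A (A ω))) / Real.log 2 := by
  unfold entropy
  rw [← sum_law_mul p A (fun a => -Real.log (law p A a))]
  simp [Real.negMulLog]

lemma entropy_law (p : Ω → ℝ) (A : Ω → α) (f : α → β) :
    entropy (law p A) f = entropy p (fun ω => f (A ω)) := by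
  simp only [entropy, law_law]

lemma condEntropy_law (p : Ω → ℝ) (L : Ω → δ) (A : δ → α) (C : δ → γ) :
    condEntropy (law p L) A C = condEntropy p (fun ω => A (L ω)) (fun ω => C (L ω)) := by
  simp only [condEntropy, entropy_law]

lemma mutualInfo_law (p : Ω → ℝ) (L : Ω → δ) (A : δ → α) (C : δ → γ) :
    mutualInfo (law p L) A C = mutualInfo p (fun ω => A (L ω)) (fun ω => C (L ω)) := by
  simp only [mutualInfo, entropy_law, condEntropy_law]

lemma condMutualInfo_law (p : Ω → ℝ) (L : Ω → δ) (A : δ → α) (B : δ → β) (C : δ → γ) :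
    condMutualInfo (law p L) A B C =
      condMutualInfo p (fun ω => A (L ω)) (fun ω => B (L ω)) (fun ω => C (L ω)) := by
  simp only [condMutualInfo, condEntropy_law]

/-- Entropy depends only on the partition that the random variable induces. -/
lemma entropy_congr (p : Ω → ℝ) {A : Ω → α} {B : Ω → β}
    (h : ∀ ω ω', A ω = A ω' ↔ B ω = B ω') : entropy p A = entropy p B := by
  rw [entropy_eq_sum, entropy_eq_sum]
  congr 1
  exact Finset.sum_congr rfl fun ω _ => by rw [law_congr p (fun ω' => h ω' ω)]

lemma condEntropy_congr (p : Ω → ℝ) {A : Ω → α} {B : Ω → β} {C : Ω → γ} {D : Ω → δ}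
    (h : ∀ ω ω', A ω = A ω' ↔ B ω = B ω') (h' : ∀ ω ω', C ω = C ω' ↔ D ω = D ω') :
    condEntropy p A C = condEntropy p B D := by
  unfold condEntropy
  rw [entropy_congr p h', entropy_congr p (B := fun ω => (B ω, D ω))]
  intro ω ω'
  simp only [Prod.mk.injEq, h ω ω', h' ω ω']

lemma condEntropy_pair (p : Ω → ℝ) (A : Ω → α) (B : Ω → β) (C : Ω → γ) :
    condEntropy p (fun ω => (A ω, B ω)) C =
      condEntropy p A C + condEntropy p B (fun ω => (A ω, C ω)) := by
  unfold condEntropy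
  rw [entropy_congr p (A := fun ω => ((A ω, B ω), C ω)) (B := fun ω => (B ω, A ω, C ω))]
  · ring
  · intro ω ω'
    simp only [Prod.mk.injEq]
    tauto

lemma condMutualInfo_eq (p : Ω → ℝ) (A : Ω → α) (B : Ω → β) (C : Ω → γ) :
    condMutualInfo p A B C = condEntropy p B C - condEntropy p B (fun ω => (A ω, C ω)) := by
  unfold condMutualInfo condEntropy
  rw [entropy_congr p (A := fun ω => (A ω, B ω, C ω)) (B := fun ω => (B ω, A ω, C ω))]
  · ring
  · intro ω ω'
    simp only [Prod.mk.injEq]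
    tauto

lemma condEntropy_eq_sum {p : Ω → ℝ} (A : Ω → α) (C : Ω → γ) :
    condEntropy p A C = (∑ ω, p ω * (Real.log (law p C (C ω)) -
      Real.log (law p (fun ω => (A ω, C ω)) (A ω, C ω)))) / Real.log 2 := by
  unfold condEntropy
  rw [entropy_eq_sum, entropy_eq_sum, ← sub_div, ← Finset.sum_sub_distrib]
  congr 1
  exact Finset.sum_congr rfl fun ω _ => by ring

/-- On outcomes of positive mass the factorization makes `k ω` the conditional probability of `A`
given `C`; null outcomes do not contribute. -/
lemma condEntropy_eq_of_kernel {p : Ω → ℝ} (hp : ∀ ω, 0 ≤ p ω) {A : Ω → α} {C : Ω → γ}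
    {k : Ω → ℝ} (h : ∀ ω, law p (fun ω => (A ω, C ω)) (A ω, C ω) = law p C (C ω) * k ω) :
    condEntropy p A C = (∑ ω, p ω * -Real.log (k ω)) / Real.log 2 := by
  rw [condEntropy_eq_sum]
  congr 1
  refine Finset.sum_congr rfl fun ω _ => ?_
  rcases (hp ω).eq_or_lt with h0 | h0
  · simp [← h0]
  · have h1 := law_pos hp C h0
    have h2 := law_pos hp (fun ω => (A ω, C ω)) h0
    simp only [h ω] at h2 ⊢
    rw [Real.log_mul h1.ne' (right_ne_zero_of_mul h2.ne')]
    ring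

/-- Gibbs' inequality, conditional form. -/
lemma condEntropy_le_of_kernel {p : Ω → ℝ} (hp : ∀ ω, 0 ≤ p ω) {A : Ω → α} {C : Ω → γ}
    (q : γ → α → ℝ) (hq : ∀ c a, 0 ≤ q c a) (hq1 : ∀ c, ∑ a, q c a ≤ 1)
    (hpos : ∀ ω, 0 < p ω → 0 < q (C ω) (A ω)) :
    condEntropy p A C ≤ (∑ ω, p ω * -Real.log (q (C ω) (A ω))) / Real.log 2 := by
  rw [condEntropy_eq_sum]
  refine div_le_div_of_nonneg_right ?_ (Real.log_nonneg one_le_two)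
  set J : α × γ → ℝ := law p (fun ω => (A ω, C ω)) with hJ
  have hJ0 : ∀ x, 0 ≤ J x := law_nonneg hp _
  -- This is log x ≤ x - 1 at x = q(a|c) P(c) / P(a, c), weighted by `p ω`. The correction terms sum
  -- to at most zero because each `q c` has total mass at most 1.
  have key : ∀ ω, p ω * (Real.log (law p C (C ω)) - Real.log (J (A ω, C ω))) ≤
      p ω * -Real.log (q (C ω) (A ω)) +
        (p ω * (q (C ω) (A ω) * law p C (C ω) / J (A ω, C ω)) - p ω) := by
    intro ω
    rcases (hp ω).eq_or_lt with h0 | h0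
    · simp [← h0]
    · have h1 := law_pos hp C h0
      have h2 : 0 < J (A ω, C ω) := law_pos hp (fun ω => (A ω, C ω)) h0
      have h3 := hpos ω h0
      have h4 := Real.log_le_sub_one_of_pos (div_pos (mul_pos h3 h1) h2)
      rw [Real.log_div (mul_pos h3 h1).ne' h2.ne', Real.log_mul h3.ne' h1.ne'] at h4
      nlinarith
  refine (Finset.sum_le_sum fun ω _ => key ω).trans ?_
  rw [Finset.sum_add_distrib, Finset.sum_sub_distrib]
  have h5 : ∑ ω, p ω * (q (C ω) (A ω) * law p C (C ω) / J (A ω, C ω)) ≤ ∑ ω, p ω := by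
    rw [← sum_law_mul p (fun ω => (A ω, C ω))
      (fun x => q x.2 x.1 * law p C x.2 / J x), ← sum_law p C, Fintype.sum_prod_type_right]
    refine Finset.sum_le_sum fun c _ => ?_
    calc ∑ a, J (a, c) * (q c a * law p C c / J (a, c)) ≤ ∑ a, q c a * law p C c := by
          refine Finset.sum_le_sum fun a _ => ?_
          rcases (hJ0 (a, c)).eq_or_lt with h0 | h0
          · simp only [← h0, zero_mul]
            exact mul_nonneg (hq _ _) (law_nonneg hp _ _)
          · rw [mul_div_cancel₀ _ h0.ne']
      _ ≤ law p C c := by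
          rw [← Finset.sum_mul]
          exact mul_le_of_le_one_left (law_nonneg hp _ _) (hq1 c)
  linarith

/-- Gibbs' inequality with the conditional law of `A` given `C`, used as a kernel that ignores `B`.
-/
lemma condEntropy_pair_le {p : Ω → ℝ} (hp : ∀ ω, 0 ≤ p ω) (A : Ω → α) (B : Ω → β) (C : Ω → γ) :
    condEntropy p A (fun ω => (B ω, C ω)) ≤ condEntropy p A C := by
  refine (condEntropy_le_of_kernel hp
    (fun (x : β × γ) a => law p (fun ω => (A ω, C ω)) (a, x.2) / law p C x.2) ?_ ?_ ?_).trans_eq ?_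
  · exact fun x a => div_nonneg (law_nonneg hp _ _) (law_nonneg hp _ _)
  · intro x
    rw [← Finset.sum_div, sum_law_prod_left]
    exact div_self_le_one _
  · exact fun ω h => div_pos (law_pos hp (fun ω => (A ω, C ω)) h) (law_pos hp C h)
  · rw [condEntropy_eq_sum]
    congr 1
    refine Finset.sum_congr rfl fun ω _ => ?_
    rcases (hp ω).eq_or_lt with h0 | h0
    · simp [← h0]
    · dsimp only
      rw [Real.log_div (law_pos hp (fun ω => (A ω, C ω)) h0).ne' (law_pos hp C h0).ne']
      ring

/-- Conditioning on more reduces entropy. -/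
lemma condEntropy_anti {p : Ω → ℝ} (hp : ∀ ω, 0 ≤ p ω) (A : Ω → α) {C : Ω → γ} {D : Ω → δ}
    (h : Determines C D) : condEntropy p A C ≤ condEntropy p A D := by
  refine le_trans (le_of_eq ?_) (condEntropy_pair_le hp A C D)
  refine condEntropy_congr p (fun _ _ => Iff.rfl) fun ω ω' => ?_
  rw [Prod.mk.injEq]
  exact ⟨fun h' => ⟨h', h h'⟩, fun h' => h'.1⟩

lemma condEntropy_const {p : Ω → ℝ} (hp : p ∈ stdSimplex ℝ Ω) (A : Ω → α) :
    condEntropy p A (fun _ => ()) = entropy p A := by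
  unfold condEntropy
  have h : entropy p (fun _ => ()) = 0 := by
    rw [entropy_eq_sum]
    simp [law, hp.2]
  rw [h, sub_zero]
  exact entropy_congr p fun ω ω' => by simp

/-- The defect from homogeneity depends on the total mass only, not on `A`. It therefore cancels in
conditional entropies, which makes these homogeneous on unnormalized laws. -/
lemma entropy_const_mul (c : ℝ) (p : Ω → ℝ) (A : Ω → α) :
    entropy (fun ω => c * p ω) A =
      c * entropy p A + Real.negMulLog c * (∑ ω, p ω) / Real.log 2 := by
  unfold entropy
  simp only [law_const_mul, Real.negMulLog_mul, Finset.sum_add_distrib, ← Finset.mul_sum,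
    ← Finset.sum_mul, sum_law]
  ring

lemma condEntropy_const_mul (c : ℝ) (p : Ω → ℝ) (A : Ω → α) (C : Ω → γ) :
    condEntropy (fun ω => c * p ω) A C = c * condEntropy p A C := by
  unfold condEntropy
  rw [entropy_const_mul, entropy_const_mul]
  ring

lemma condMutualInfo_const_mul (c : ℝ) (p : Ω → ℝ) (A : Ω → α) (B : Ω → β) (C : Ω → γ) :
    condMutualInfo (fun ω => c * p ω) A B C = c * condMutualInfo p A B C := by
  unfold condMutualInfo
  rw [condEntropy_const_mul, condEntropy_const_mul]
  ring

/-- Since `A` reveals the index, its level sets lie in single fibers. The fibers carry unnormalized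
laws, so no weights appear in the sum. -/
lemma entropy_eq_sum_fiber (p : ι × Ω → ℝ) {A : ι × Ω → α} (h : Determines A Prod.fst) :
    entropy p A = ∑ i, entropy (fun ω => p (i, ω)) (fun ω => A (i, ω)) := by
  classical
  have hl : ∀ i ω, law p A (A (i, ω)) = law (fun ω => p (i, ω)) (fun ω => A (i, ω)) (A (i, ω)) := by
    intro i ω
    rw [law_eq_sum_ite, law_eq_sum_ite, Fintype.sum_prod_type, Finset.sum_eq_single i]
    · intro j _ hj
      refine Finset.sum_eq_zero fun ω' _ => if_neg fun h' => hj (h h')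
    · simp
  simp only [entropy_eq_sum, ← Finset.sum_div]
  rw [Fintype.sum_prod_type]
  simp only [hl]

lemma condEntropy_eq_sum_fiber (p : ι × Ω → ℝ) (A : ι × Ω → α) {C : ι × Ω → γ}
    (h : Determines C Prod.fst) :
    condEntropy p A C =
      ∑ i, condEntropy (fun ω => p (i, ω)) (fun ω => A (i, ω)) (fun ω => C (i, ω)) := by
  unfold condEntropy
  rw [entropy_eq_sum_fiber p h, entropy_eq_sum_fiber p (A := fun ω => (A ω, C ω)),
    ← Finset.sum_sub_distrib]
  exact fun ω ω' h' => h (Prod.ext_iff.1 h').2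

lemma condMutualInfo_eq_sum_fiber (p : ι × Ω → ℝ) (A : ι × Ω → α) (B : ι × Ω → β) {C : ι × Ω → γ}
    (h : Determines C Prod.fst) :
    condMutualInfo p A B C = ∑ i, condMutualInfo (fun ω => p (i, ω)) (fun ω => A (i, ω))
      (fun ω => B (i, ω)) (fun ω => C (i, ω)) := by
  unfold condMutualInfo
  rw [condEntropy_eq_sum_fiber p A h, condEntropy_eq_sum_fiber p A (C := fun ω => (B ω, C ω)),
    ← Finset.sum_sub_distrib]
  exact fun ω ω' h' => h (Prod.ext_iff.1 h').2

open Classical in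
/-- Fano's inequality for an estimate `f C` of `A`. -/
lemma condEntropy_le_of_estimate {p : Ω → ℝ} (hp : p ∈ stdSimplex ℝ Ω) (A : Ω → α) (C : Ω → γ)
    (f : γ → α) :
    condEntropy p A C ≤
      1 + (∑ ω with f (C ω) ≠ A ω, p ω) * (Real.log (Fintype.card α) / Real.log 2) := by
  obtain ⟨ω₀⟩ : Nonempty Ω := by
    by_contra h
    rw [not_nonempty_iff] at h
    simpa using hp.2
  have hM : (0 : ℝ) < Fintype.card α := Nat.cast_pos.2 (Fintype.card_pos_iff.2 ⟨A ω₀⟩)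
  set m : ℝ := (Fintype.card α : ℝ) with hm
  have h2 : 0 < Real.log 2 := Real.log_pos one_lt_two
  -- The comparison kernel puts half its mass on the estimate and spreads the other half uniformly.
  -- A correct estimate costs at most one bit, a wrong one costs one bit plus log m.
  refine (condEntropy_le_of_kernel hp.1 (fun c a => if f c = a then 1 / 2 + 1 / (2 * m)
    else 1 / (2 * m)) (fun c a => by positivity) (fun c => ?_) (fun ω _ => by positivity)).trans ?_
  · have h : ∀ a, (if f c = a then 1 / 2 + 1 / (2 * m) else 1 / (2 * m)) =
        (if f c = a then 1 / 2 else 0) + 1 / (2 * m) := fun a => by split_ifs <;> ring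
    simp only [h, Finset.sum_add_distrib, Finset.sum_ite_eq, Finset.mem_univ, if_true,
      Finset.sum_const, Finset.card_univ, nsmul_eq_mul, ← hm]
    apply le_of_eq
    field_simp
    norm_num
  · have h : ∀ ω, p ω * -Real.log (if f (C ω) = A ω then 1 / 2 + 1 / (2 * m) else 1 / (2 * m)) ≤
        p ω * Real.log 2 + (if f (C ω) ≠ A ω then p ω else 0) * Real.log m := by
      intro ω
      by_cases h1 : f (C ω) = A ω
      · simp only [h1, if_true, ne_eq, not_true_eq_false, if_false, zero_mul, add_zero]
        have : Real.log (1 / 2) ≤ Real.log (1 / 2 + 1 / (2 * m)) :=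
          Real.log_le_log (by norm_num) (by simp [hM.le])
        rw [one_div, Real.log_inv] at this
        nlinarith [hp.1 ω]
      · simp only [h1, if_false, ne_eq, not_false_eq_true, if_true]
        rw [one_div, Real.log_inv, Real.log_mul two_ne_zero hM.ne']
        linarith
    rw [div_le_iff₀ h2]
    refine (Finset.sum_le_sum fun ω _ => h ω).trans_eq ?_
    rw [Finset.sum_add_distrib, ← Finset.sum_mul, ← Finset.sum_mul, hp.2, Finset.sum_filter]
    field_simp

omit [Fintype α] in
/-- Existence of a conditional law. -/
lemma exists_condLaw {p : Ω → ℝ} (hp : p ∈ stdSimplex ℝ Ω) (V : Ω → α) (A : Ω → β) :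
    ∃ κ : α → β → ℝ, (∀ v, κ v ∈ stdSimplex ℝ β) ∧
      ∀ v b, law p V v * κ v b = law p (fun ω => (V ω, A ω)) (v, b) := by
  classical
  obtain ⟨ω₀⟩ : Nonempty Ω := by
    by_contra h
    rw [not_nonempty_iff] at h
    simpa using hp.2
  have hsum : ∀ v, ∑ b, law p (fun ω => (V ω, A ω)) (v, b) = law p V v := fun v => by
    rw [← sum_law_prod_left p A V v]
    exact Finset.sum_congr rfl fun b _ => law_congr p fun ω => by simp [and_comm]
  -- Where `v` has mass zero, any point mass serves; `A ω₀` only witnesses that the alphabet is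
  -- nonempty.
  refine ⟨fun v b => if law p V v = 0 then (if b = A ω₀ then 1 else 0)
    else law p (fun ω => (V ω, A ω)) (v, b) / law p V v, fun v => ?_, fun v b => ?_⟩
  · by_cases hv : law p V v = 0
    · simp only [hv, if_true]
      exact ⟨fun b => by positivity, by simp⟩
    · simp only [hv, if_false]
      refine ⟨fun b => div_nonneg (law_nonneg hp.1 _ _) (law_nonneg hp.1 _ _), ?_⟩
      rw [← Finset.sum_div, hsum, div_self hv]
  · by_cases hv : law p V v = 0
    · simp only [hv, zero_mul]
      have h0 := hsum v
      rw [hv, Finset.sum_eq_zero_iff_of_nonneg fun b _ => law_nonneg hp.1 _ _] at h0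
      exact (h0 b (Finset.mem_univ b)).symm
    · simp only [hv, if_false]
      field_simp

end Information

/-! ### Conditional entropies under a transition kernel -/

section Markov

variable {Ω φ ξ α β γ δ ε : Type*} [Fintype Ω] [Fintype α] [Fintype β] [Fintype γ] [Fintype δ]
  [Fintype ε]

open Classical in
/-- Given the past `F`, the variable `A` has conditional law `κ X`. -/
def IsTransition (p : Ω → ℝ) (F : Ω → φ) (X : Ω → ξ) (A : Ω → α) (κ : ξ → α → ℝ) : Prop :=
  ∀ Φ : Ω → ℝ, Determines F Φ → ∀ a,
    ∑ ω, p ω * (if A ω = a then Φ ω else 0) = ∑ ω, p ω * (Φ ω * κ (X ω) a)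

variable {p : Ω → ℝ} {F : Ω → φ} {X : Ω → ξ} {A : Ω → α} {κ : ξ → α → ℝ}

-- Test the transition property on the indicator of the event that `V` takes its value at `ω`; on
-- this event the kernel probability is constant and factors out.
omit [Fintype β] [Fintype γ] in
lemma IsTransition.law_eq (h : IsTransition p F X A κ) (g : α → β) {V : Ω → γ}
    (hV : Determines F V) (hX : ∀ b, Determines V fun ω => law (κ (X ω)) g b) (ω : Ω) (b : β) :
    law p (fun ω => (g (A ω), V ω)) (b, V ω) = law p V (V ω) * law (κ (X ω)) g b := by
  classical
  set Φ : Ω → ℝ := fun ω' => if V ω' = V ω then 1 else 0 with hΦ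
  have hΦd : Determines F Φ := fun x y hxy => by simp only [hΦ, hV hxy]
  have h1 : law p (fun ω => (g (A ω), V ω)) (b, V ω) =
      ∑ a with g a = b, ∑ ω', p ω' * (if A ω' = a then Φ ω' else 0) := by
    rw [law_eq_sum_ite, Finset.sum_comm]
    refine Finset.sum_congr rfl fun ω' _ => ?_
    rw [Finset.sum_filter]
    simp only [hΦ, mul_ite, mul_one, mul_zero, Prod.mk.injEq, ite_and]
    rw [Finset.sum_eq_single (A ω')]
    · split_ifs <;> simp_all
    · intro a _ ha
      simp [ha.symm]
    · simp
  rw [h1, Finset.sum_congr rfl fun a _ => h Φ hΦd a, Finset.sum_comm, law_eq_sum_ite p V,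
    Finset.sum_mul]
  refine Finset.sum_congr rfl fun ω' _ => ?_
  rw [← Finset.mul_sum, ← Finset.mul_sum]
  simp only [hΦ]
  split_ifs with hv
  · have := hX b hv
    simp only at this
    rw [one_mul, ← this]
    rfl
  · simp

/-- Both sides equal the expected negative logarithm of the same kernel probability. -/
lemma IsTransition.condEntropy_eq (h : IsTransition p F X A κ) (hp : ∀ ω, 0 ≤ p ω) (g : α → β)
    {V : Ω → γ} {V' : Ω → δ} (hV : Determines F V)
    (hX : ∀ b, Determines V fun ω => law (κ (X ω)) g b) (hV' : Determines F V')
    (hX' : ∀ b, Determines V' fun ω => law (κ (X ω)) g b) :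
    condEntropy p (fun ω => g (A ω)) V = condEntropy p (fun ω => g (A ω)) V' := by
  rw [condEntropy_eq_of_kernel hp (fun ω => h.law_eq g hV hX ω _),
    condEntropy_eq_of_kernel hp (fun ω => h.law_eq g hV' hX' ω _)]

/-- The conditional entropy of one function of `A` given another one and `V` depends on `V` only
through `X`. -/
lemma IsTransition.condEntropy_pair_eq (h : IsTransition p F X A κ) (hp : ∀ ω, 0 ≤ p ω) (g : α → β)
    (g' : α → ε) {V : Ω → γ} {V' : Ω → δ} (hV : Determines F V) (hX : Determines V X)
    (hV' : Determines F V') (hX' : Determines V' X) :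
    condEntropy p (fun ω => g (A ω)) (fun ω => (g' (A ω), V ω)) =
      condEntropy p (fun ω => g (A ω)) (fun ω => (g' (A ω), V' ω)) := by
  have h1 := condEntropy_pair p (fun ω => g' (A ω)) (fun ω => g (A ω)) V
  have h2 := condEntropy_pair p (fun ω => g' (A ω)) (fun ω => g (A ω)) V'
  have h3 := h.condEntropy_eq hp g' hV (fun b _ _ e => by simp only [hX e]) hV'
    (fun b _ _ e => by simp only [hX' e])
  have h4 := h.condEntropy_eq hp (fun a => (g' a, g a)) hV (fun b _ _ e => by simp only [hX e]) hV'
    (fun b _ _ e => by simp only [hX' e])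
  linarith

end Markov

/-! ### Carathéodory-type support reduction -/

section SupportReduction

variable {τ ξ : Type*} [Fintype τ] [Fintype ξ]

/-- Weights that represent the same mixture as the constant weight `1`, with at most as many
nonzero weights as there are linear functionals to be preserved; one further functional does not
decrease. -/
lemma exists_weights_card_support_le (a : τ → ξ → ℝ) (g m : τ → ℝ)
    (hm : ∀ v : τ → ℝ, (∀ x, ∑ t, v t * a t x = 0) → ∑ t, v t * m t = 0) (hm0 : ∀ t, 0 ≤ m t)
    (ha0 : ∀ t, m t = 0 → a t = 0) (hg0 : ∀ t, m t = 0 → g t = 0) :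
    ∃ (s : Finset τ) (w : τ → ℝ), s.card ≤ Fintype.card ξ ∧ (∀ t, 0 ≤ w t) ∧
      (∀ t ∉ s, w t = 0) ∧ (∀ x, ∑ t, w t * a t x = ∑ t, a t x) ∧ ∑ t, g t ≤ ∑ t, w t * g t := by
  classical
  -- Induction on the support size, starting from the unit weights with the indices of zero mass
  -- already discarded.
  suffices H : ∀ (N : ℕ) (s : Finset τ) (w : τ → ℝ), s.card ≤ N → (∀ t ∈ s, m t ≠ 0) →
      (∀ t, 0 ≤ w t) → (∀ t ∉ s, w t = 0) → (∀ x, ∑ t, w t * a t x = ∑ t, a t x) →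
      ∑ t, g t ≤ ∑ t, w t * g t → ∃ (s : Finset τ) (w : τ → ℝ), s.card ≤ Fintype.card ξ ∧
      (∀ t, 0 ≤ w t) ∧ (∀ t ∉ s, w t = 0) ∧ (∀ x, ∑ t, w t * a t x = ∑ t, a t x) ∧
      ∑ t, g t ≤ ∑ t, w t * g t by
    refine H _ (Finset.univ.filter fun t => m t ≠ 0) (fun t => if m t = 0 then 0 else 1) le_rfl
      (by simp) (fun t => by positivity) (by simp) (fun x => ?_) (Finset.sum_le_sum fun t _ => ?_)
    · refine Finset.sum_congr rfl fun t _ => ?_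
      split_ifs with h
      · simp [ha0 t h]
      · simp
    · split_ifs with h
      · simp [hg0 t h]
      · simp
  intro N
  induction N with
  | zero =>
    intro s w hs _ h1 h2 h3 h4
    exact ⟨s, w, hs.trans (Nat.zero_le _), h1, h2, h3, h4⟩
  | succ N ih =>
    intro s w hs hsm h1 h2 h3 h4
    by_cases hc : s.card ≤ Fintype.card ξ
    · exact ⟨s, w, hc, h1, h2, h3, h4⟩
    have hdep : ¬ LinearIndependent ℝ (fun t : s => a t) := fun hl => by
      have := hl.fintype_card_le_finrank
      simp only [Fintype.card_coe, Module.finrank_fintype_fun_eq_card] at this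
      exact hc this
    rw [Fintype.not_linearIndependent_iff] at hdep
    obtain ⟨u, hu, ⟨t₀, ht₀⟩, hut⟩ := hdep
    -- A linear relation among the vectors `a t` is a direction that keeps all preserved
    -- functionals; its sign is chosen so that `g` does not decrease.
    obtain ⟨v, hvs, hv, hvg, hv0⟩ : ∃ v : τ → ℝ, (∀ t ∉ s, v t = 0) ∧
        (∀ x, ∑ t, v t * a t x = 0) ∧ 0 ≤ ∑ t, v t * g t ∧ ∃ t ∈ s, v t ≠ 0 := by
      set v₀ : τ → ℝ := fun t => if h : t ∈ s then u ⟨t, h⟩ else 0 with hv₀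
      have e1 : ∀ t ∉ s, v₀ t = 0 := fun t ht => by simp [hv₀, ht]
      have e2 : ∀ x, ∑ t, v₀ t * a t x = 0 := fun x => by
        rw [← Finset.sum_subset (Finset.subset_univ s) (fun t _ ht => by simp [e1 t ht]),
          ← Finset.sum_coe_sort]
        have := congrFun hu x
        simpa [hv₀, Finset.sum_apply] using this
      have e3 : v₀ t₀ ≠ 0 := by simpa [hv₀, ht₀] using hut
      rcases le_total 0 (∑ t, v₀ t * g t) with h | h
      · exact ⟨v₀, e1, e2, h, t₀, ht₀, e3⟩
      · refine ⟨-v₀, fun t ht => by simp [e1 t ht], fun x => ?_, ?_, t₀, ht₀, by simpa using e3⟩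
        · simpa using e2 x
        · simpa using h
    -- The relation also annihilates `m`, which is positive on `s`, so a nonzero `v` cannot be
    -- nonnegative.
    obtain ⟨t₁, ht₁, hneg⟩ : ∃ t ∈ s, v t < 0 := by
      by_contra! hcon
      obtain ⟨t, ht, hvt⟩ := hv0
      have h0 := hm v hv
      have hnn : ∀ t ∈ Finset.univ, 0 ≤ v t * m t := fun t _ => by
        by_cases hts : t ∈ s
        · exact mul_nonneg (hcon t hts) (hm0 t)
        · simp [hvs t hts]
      rw [Finset.sum_eq_zero_iff_of_nonneg hnn] at h0
      exact mul_ne_zero hvt (hsm t ht) (h0 t (Finset.mem_univ t))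
    -- Move along `v` until the first weight reaches zero; the minimal ratio is the step length that
    -- keeps all weights nonnegative.
    obtain ⟨t₂, ht₂, hmin⟩ := Finset.exists_min_image (s.filter fun t => v t < 0)
      (fun t => w t / -v t) ⟨t₁, by simp [ht₁, hneg]⟩
    simp only [Finset.mem_filter] at ht₂ hmin
    set θ := w t₂ / -v t₂ with hθ
    have hθ0 : 0 ≤ θ := div_nonneg (h1 t₂) (by linarith [ht₂.2])
    refine ih (s.erase t₂) (fun t => w t + θ * v t) ?_ ?_ ?_ ?_ ?_ ?_
    · rw [Finset.card_erase_of_mem ht₂.1]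
      omega
    · exact fun t ht => hsm t (Finset.mem_of_mem_erase ht)
    · intro t
      rcases le_or_gt 0 (v t) with h | h
      · exact add_nonneg (h1 t) (mul_nonneg hθ0 h)
      · have hts : t ∈ s := by
          by_contra hts
          exact h.ne (hvs t hts)
        have := hmin t ⟨hts, h⟩
        rw [le_div_iff₀ (by linarith)] at this
        linarith
    · intro t ht
      by_cases h : t = t₂
      · subst h
        rw [hθ]
        have := ht₂.2.ne
        field_simp
        ring
      · have hts : t ∉ s := fun hts => ht (Finset.mem_erase.2 ⟨h, hts⟩)
        rw [h2 t hts, hvs t hts]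
        ring
    · intro x
      simp only [add_mul, Finset.sum_add_distrib, mul_assoc, ← Finset.mul_sum, hv x, h3 x]
      ring
    · simp only [add_mul, Finset.sum_add_distrib, mul_assoc, ← Finset.mul_sum]
      linarith [mul_nonneg hθ0 hvg]

end SupportReduction

lemma condMutualInfo_congr {Ω α β γ δ : Type*} [Fintype Ω] [Fintype α] [Fintype β] [Fintype γ]
    [Fintype δ] (p : Ω → ℝ) (A : Ω → α) (B : Ω → β) {C : Ω → γ} {D : Ω → δ}
    (h : ∀ ω ω', C ω = C ω' ↔ D ω = D ω') : condMutualInfo p A B C = condMutualInfo p A B D := by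
  unfold condMutualInfo
  rw [condEntropy_congr p (fun _ _ => Iff.rfl) h,
    condEntropy_congr p (A := A) (B := A) (C := fun ω => (B ω, C ω)) (D := fun ω => (B ω, D ω))
      (fun _ _ => Iff.rfl) fun ω ω' => by rw [Prod.mk.injEq, Prod.mk.injEq, h]]

lemma law_equiv {Ω α : Type*} [Fintype Ω] (p : Ω → ℝ) (e : Ω ≃ α) (a : α) :
    law p e a = p (e.symm a) := by
  classical
  rw [law_eq_sum_ite]
  simp only [← e.eq_symm_apply]
  simp

lemma pair_eq_of_eq {X : Fin 2 → Type*} {x x' : ∀ k, X k} (k : Fin 2) (h : x k = x' k)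
    (h' : x (1 - k) = x' (1 - k)) : x = x' := by
  funext j
  fin_cases k <;> fin_cases j <;> assumption

/-! ### The single-letter law and the cardinality bound -/

section SingleLetter

variable {X Z ST Sh : Fin 2 → Type*} {S SR Y : Type*}
  [∀ k, Fintype (X k)] [∀ k, Fintype (Z k)] [∀ k, Fintype (ST k)] [∀ k, Fintype (Sh k)]
  [Fintype S] [Fintype SR] [Fintype Y]

namespace Model

variable (M : Model X Z ST Sh S SR Y)

/-- The conditional law of the states and the outputs given the inputs. -/
def kernel (x : ∀ k, X k) (a : (S × (∀ k, ST k) × SR) × (Y × (∀ k, Z k))) : ℝ :=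
  M.stateLaw a.1 * M.channel x a.1.1 a.2

lemma kernel_mem (x : ∀ k, X k) :
    M.kernel x ∈ stdSimplex ℝ ((S × (∀ k, ST k) × SR) × (Y × (∀ k, Z k))) := by
  refine ⟨fun a => mul_nonneg (M.stateLaw_mem.1 _) ((M.channel_mem _ _).1 _), ?_⟩
  unfold kernel
  rw [Fintype.sum_prod_type]
  simp only [← Finset.mul_sum, (M.channel_mem _ _).2, mul_one, M.stateLaw_mem.2]

/-- The law of the inputs, states and outputs when the inputs have the law `u`. -/
def slotLaw (u : (∀ k, X k) → ℝ)
    (ω : (∀ k, X k) × (S × (∀ k, ST k) × SR) × (Y × (∀ k, Z k))) : ℝ :=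
  u ω.1 * M.kernel ω.1 ω.2

lemma slotLaw_const_mul (c : ℝ) (u : (∀ k, X k) → ℝ) :
    M.slotLaw (fun x => c * u x) = fun ω => c * M.slotLaw u ω := by
  funext ω
  simp only [slotLaw, mul_assoc]

/-- The unnormalized `I(X_k ; Y Z | S_R X_k̄)`. -/
def rateInfo (k : Fin 2) (u : (∀ k, X k) → ℝ) : ℝ :=
  condMutualInfo (M.slotLaw u) (fun ω => ω.1 k) (fun ω => (ω.2.2.1, ω.2.2.2))
    (fun ω => (ω.2.1.2.2, ω.1 (1 - k)))

/-- The unnormalized `I(X ; Y Z | S_R)`. -/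
def sumInfo (u : (∀ k, X k) → ℝ) : ℝ :=
  condMutualInfo (M.slotLaw u) (fun ω => ω.1) (fun ω => (ω.2.2.1, ω.2.2.2))
    (fun ω => ω.2.1.2.2)

/-- The unnormalized `I(X_1 ; X_2 | Z) - I(X_1 ; X_2)`. -/
def balanceInfo (u : (∀ k, X k) → ℝ) : ℝ :=
  condMutualInfo (M.slotLaw u) (fun ω => ω.1 0) (fun ω => ω.1 1) (fun ω => ω.2.2.2) -
    condMutualInfo (M.slotLaw u) (fun ω => ω.1 0) (fun ω => ω.1 1) (fun _ => ())

lemma rateInfo_const_mul (k : Fin 2) (c : ℝ) (u : (∀ k, X k) → ℝ) :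
    M.rateInfo k (fun x => c * u x) = c * M.rateInfo k u := by
  rw [rateInfo, slotLaw_const_mul, condMutualInfo_const_mul, rateInfo]

lemma sumInfo_const_mul (c : ℝ) (u : (∀ k, X k) → ℝ) :
    M.sumInfo (fun x => c * u x) = c * M.sumInfo u := by
  rw [sumInfo, slotLaw_const_mul, condMutualInfo_const_mul, sumInfo]

lemma balanceInfo_const_mul (c : ℝ) (u : (∀ k, X k) → ℝ) :
    M.balanceInfo (fun x => c * u x) = c * M.balanceInfo u := by
  rw [balanceInfo, slotLaw_const_mul, condMutualInfo_const_mul, condMutualInfo_const_mul,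
    balanceInfo, mul_sub]

variable {𝒬 𝒬Z : Type*} [Fintype 𝒬] [Fintype 𝒬Z] (P : (𝒬 × 𝒬Z) × (∀ k, X k) → ℝ)

/-- The marginal law of the inputs. -/
def inputLaw (x : ∀ k, X k) : ℝ := ∑ t, P (t, x)

omit [Fintype 𝒬] [Fintype 𝒬Z] in
lemma letterLaw_eq (ω : Letter 𝒬 𝒬Z X Z ST S SR Y) :
    M.letterLaw P ω = P ω.1 * M.kernel ω.x ω.2 := mul_assoc _ _ _

variable {P} in
lemma letterLaw_mem (hP : P ∈ stdSimplex ℝ ((𝒬 × 𝒬Z) × (∀ k, X k))) :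
    M.letterLaw P ∈ stdSimplex ℝ (Letter 𝒬 𝒬Z X Z ST S SR Y) := by
  refine ⟨fun ω => ?_, ?_⟩
  · rw [letterLaw_eq]
    exact mul_nonneg (hP.1 _) ((M.kernel_mem _).1 _)
  · rw [Fintype.sum_prod_type]
    have h : ∀ t : (𝒬 × 𝒬Z) × (∀ k, X k), ∑ a, M.kernel t.2 a = 1 := fun t => (M.kernel_mem _).2
    simp only [letterLaw_eq, ← Finset.mul_sum, h, mul_one, hP.2]

/-- The law is a product in which the kernel sees the inputs only, and it sums to one over the
states and outputs. -/
lemma letterLaw_isTransition :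
    IsTransition (M.letterLaw P) (fun ω : Letter 𝒬 𝒬Z X Z ST S SR Y => ω.1) (fun ω => ω.x)
      (fun ω => ω.2) M.kernel := by
  classical
  intro Φ hΦ a
  have hs : ∀ f : Letter 𝒬 𝒬Z X Z ST S SR Y → ℝ, ∑ ω, f ω = ∑ t, ∑ b, f (t, b) :=
    fun f => Fintype.sum_prod_type f
  rw [hs, hs]
  refine Finset.sum_congr rfl fun t _ => ?_
  have h : ∀ b, Φ (t, b) = Φ (t, a) := fun b => hΦ rfl
  simp only [letterLaw_eq, mul_ite, mul_zero, Finset.sum_ite_eq', Finset.mem_univ, if_true, h]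
  have h2 : ∀ b, P t * M.kernel t.2 b * (Φ (t, a) * M.kernel t.2 a) =
      P t * (Φ (t, a) * M.kernel t.2 a) * M.kernel t.2 b := fun b => by ring
  simp only [h2, ← Finset.mul_sum, (M.kernel_mem _).2]
  ring

lemma law_letterLaw_slot :
    law (M.letterLaw P) (fun ω : Letter 𝒬 𝒬Z X Z ST S SR Y => (ω.x, ω.2)) =
      M.slotLaw (inputLaw P) := by
  classical
  funext a
  obtain ⟨x, a⟩ := a
  rw [law_eq_sum_ite, Fintype.sum_prod_type, Fintype.sum_prod_type]
  simp only [letterLaw_eq, Prod.mk.injEq, ite_and, slotLaw, inputLaw, Finset.sum_mul]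
  refine Finset.sum_congr rfl fun t _ => ?_
  rw [Finset.sum_eq_single x]
  · simp
  · intro x' _ hx
    simp [hx]
  · simp

lemma condMutualInfo_letterLaw_slot {α β γ : Type*} [Fintype α] [Fintype β] [Fintype γ]
    (A : (∀ k, X k) × (S × (∀ k, ST k) × SR) × (Y × (∀ k, Z k)) → α)
    (B : (∀ k, X k) × (S × (∀ k, ST k) × SR) × (Y × (∀ k, Z k)) → β)
    (C : (∀ k, X k) × (S × (∀ k, ST k) × SR) × (Y × (∀ k, Z k)) → γ) :
    condMutualInfo (M.letterLaw P) (fun ω => A (ω.x, ω.2)) (fun ω => B (ω.x, ω.2))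
      (fun ω => C (ω.x, ω.2)) = condMutualInfo (M.slotLaw (inputLaw P)) A B C := by
  rw [← law_letterLaw_slot, condMutualInfo_law]

/-- Conditioning on `T` splits the information into contributions of the unnormalized slices `P (t,
·)`. This additivity lets the reweighting of slices act linearly. -/
lemma condMutualInfo_letterLaw_fiber {α β γ : Type*} [Fintype α] [Fintype β] [Fintype γ]
    (A : (∀ k, X k) × (S × (∀ k, ST k) × SR) × (Y × (∀ k, Z k)) → α)
    (B : (∀ k, X k) × (S × (∀ k, ST k) × SR) × (Y × (∀ k, Z k)) → β)
    (C : (∀ k, X k) × (S × (∀ k, ST k) × SR) × (Y × (∀ k, Z k)) → γ) :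
    condMutualInfo (M.letterLaw P) (fun ω => A (ω.x, ω.2)) (fun ω => B (ω.x, ω.2))
      (fun ω => (C (ω.x, ω.2), ω.t)) =
      ∑ t, condMutualInfo (M.slotLaw fun x => P (t, x)) A B C := by
  have h : M.letterLaw P = law (fun y : (𝒬 × 𝒬Z) × (∀ k, X k) × (S × (∀ k, ST k) × SR) ×
      (Y × (∀ k, Z k)) => M.slotLaw (fun x => P (y.1, x)) y.2) (Equiv.prodAssoc _ _ _).symm := by
    funext ω
    rw [law_equiv]
    exact M.letterLaw_eq P ω
  rw [h, condMutualInfo_law, condMutualInfo_eq_sum_fiber]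
  · refine Finset.sum_congr rfl fun t _ => ?_
    exact condMutualInfo_congr _ _ _ fun ω ω' => by simp
  · intro ω ω' h
    simpa using (Prod.ext_iff.1 h).2

lemma rateInfo_letterLaw (k : Fin 2) :
    condMutualInfo (M.letterLaw P) (fun ω => ω.x k) (fun ω => (ω.y, ω.z))
      (fun ω => (ω.sR, ω.x (1 - k), ω.t)) = ∑ t, M.rateInfo k fun x => P (t, x) := by
  rw [condMutualInfo_congr (D := fun ω => ((ω.sR, ω.x (1 - k)), ω.t))]
  · exact M.condMutualInfo_letterLaw_fiber P (fun ω => ω.1 k) (fun ω => (ω.2.2.1, ω.2.2.2))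
      (fun ω => (ω.2.1.2.2, ω.1 (1 - k)))
  · intro ω ω'
    simp only [Prod.mk.injEq, and_assoc]

lemma sumInfo_letterLaw :
    condMutualInfo (M.letterLaw P) (fun ω => ω.x) (fun ω => (ω.y, ω.z))
      (fun ω => (ω.sR, ω.t)) = ∑ t, M.sumInfo fun x => P (t, x) :=
  M.condMutualInfo_letterLaw_fiber P (fun ω => ω.1) (fun ω => (ω.2.2.1, ω.2.2.2))
      (fun ω => ω.2.1.2.2)

lemma balanceInfo_letterLaw :
    condMutualInfo (M.letterLaw P) (fun ω => ω.x 0) (fun ω => ω.x 1) (fun ω => (ω.z, ω.t)) -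
      condMutualInfo (M.letterLaw P) (fun ω => ω.x 0) (fun ω => ω.x 1) (fun ω => ω.t) =
      ∑ t, M.balanceInfo fun x => P (t, x) := by
  unfold balanceInfo
  rw [Finset.sum_sub_distrib, ← condMutualInfo_letterLaw_fiber, ← condMutualInfo_letterLaw_fiber]
  congr 1
  exact condMutualInfo_congr _ _ _ fun ω ω' => by simp

variable {P}

/-- Dropping `Q` raises H(Z_k | X_k, Q) and leaves the subtracted term unchanged, since given
S_{T_k} and both inputs the feedback does not depend on `Q`. Hence a constant `Q` loses nothing. -/
lemma sensing_own_le (hP : P ∈ stdSimplex ℝ ((𝒬 × 𝒬Z) × (∀ k, X k))) (k : Fin 2) :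
    condMutualInfo (M.letterLaw P)
      (fun ω => (ω.sT k, ω.x (1 - k))) (fun ω => ω.z k) (fun ω => (ω.x k, ω.q)) ≤
    condMutualInfo (M.letterLaw P)
      (fun ω => (ω.sT k, ω.x (1 - k))) (fun ω => ω.z k) (fun ω => ω.x k) := by
  have hp := (M.letterLaw_mem hP).1
  rw [condMutualInfo_eq, condMutualInfo_eq]
  refine sub_le_sub (condEntropy_anti hp _ fun ω ω' h => (Prod.ext_iff.1 h).1) (le_of_eq ?_)
  rw [condEntropy_congr _ (C := fun ω : Letter 𝒬 𝒬Z X Z ST S SR Y => ((ω.sT k, ω.x (1 - k)), ω.x k))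
    (D := fun ω : Letter 𝒬 𝒬Z X Z ST S SR Y => (ω.sT k, ω.x)) (fun _ _ => Iff.rfl),
    condEntropy_congr _ (C := fun ω : Letter 𝒬 𝒬Z X Z ST S SR Y => ((ω.sT k, ω.x (1 - k)), ω.x k, ω.q))
    (D := fun ω : Letter 𝒬 𝒬Z X Z ST S SR Y => (ω.sT k, (ω.x, ω.q))) (fun _ _ => Iff.rfl)]
  · exact (M.letterLaw_isTransition P).condEntropy_pair_eq hp (fun a => a.2.2 k)
      (fun a => a.1.2.1 k) (fun _ _ h => (Prod.ext_iff.1 h).2) (fun _ _ h => h)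
      (fun _ _ h => Prod.ext (congrArg (fun t => t.2) h) (congrArg (fun t => t.1.1) h)) (fun _ _ h => (Prod.ext_iff.1 h).1)
  · intro ω ω'
    simp only [Prod.mk.injEq]
    exact ⟨fun h => ⟨h.1.1, pair_eq_of_eq k h.2.1 h.1.2, h.2.2⟩,
      fun h => ⟨⟨h.1, congrFun h.2.1 _⟩, congrFun h.2.1 _, h.2.2⟩⟩
  · intro ω ω'
    simp only [Prod.mk.injEq]
    exact ⟨fun h => ⟨h.1.1, pair_eq_of_eq k h.2 h.1.2⟩,
      fun h => ⟨⟨h.1, congrFun h.2 _⟩, congrFun h.2 _⟩⟩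

lemma sensing_joint_le (hP : P ∈ stdSimplex ℝ ((𝒬 × 𝒬Z) × (∀ k, X k))) (k : Fin 2) :
    condMutualInfo (M.letterLaw P)
      (fun ω => ω.sT k) (fun ω => ω.z) (fun ω => (ω.x, ω.q)) ≤
    condMutualInfo (M.letterLaw P)
      (fun ω => ω.sT k) (fun ω => ω.z) (fun ω => ω.x) := by
  have hp := (M.letterLaw_mem hP).1
  rw [condMutualInfo_eq, condMutualInfo_eq]
  refine sub_le_sub (condEntropy_anti hp _ fun ω ω' h => (Prod.ext_iff.1 h).1) (le_of_eq ?_)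
  exact (M.letterLaw_isTransition P).condEntropy_pair_eq hp (fun a => a.2.2)
      (fun a => a.1.2.1 k) (fun _ _ h => (Prod.ext_iff.1 h).2) (fun _ _ h => h)
      (fun _ _ h => Prod.ext (congrArg (fun t => t.2) h) (congrArg (fun t => t.1.1) h)) (fun _ _ h => (Prod.ext_iff.1 h).1)

variable {M} in
/-- The constraints only become weaker if the auxiliary variables are replaced so that the input
law is kept, the conditional informations given `T` do not decrease, and `Q` is constant. -/
lemma OuterConstraints.of_inputLaw_eq {𝒬' 𝒬Z' : Type*} [Fintype 𝒬'] [Fintype 𝒬Z'] [Subsingleton 𝒬']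
    {P' : (𝒬' × 𝒬Z') × (∀ k, X k) → ℝ} {R D : Fin 2 → ℝ}
    (hP : P ∈ stdSimplex ℝ ((𝒬 × 𝒬Z) × (∀ k, X k))) (h : M.OuterConstraints P R D)
    (hx : inputLaw P' = inputLaw P)
    (hr : ∀ k, ∑ t, M.rateInfo k (fun x => P (t, x)) ≤ ∑ t, M.rateInfo k fun x => P' (t, x))
    (hs : ∑ t, M.sumInfo (fun x => P (t, x)) ≤ ∑ t, M.sumInfo fun x => P' (t, x))
    (hb : ∑ t, M.balanceInfo (fun x => P (t, x)) ≤ ∑ t, M.balanceInfo fun x => P' (t, x)) :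
    M.OuterConstraints P' R D := by
  -- The joint law of inputs, states and outputs is a function of the input law, so every quantity
  -- that does not involve `T` is the same for both laws.
  have hslot := (M.law_letterLaw_slot P').trans (hx ▸ (M.law_letterLaw_slot P).symm)
  have htriple : ∀ k, law (M.letterLaw P') (fun ω => (ω.x k, ω.z k, ω.sT k)) =
      law (M.letterLaw P) (fun ω => (ω.x k, ω.z k, ω.sT k)) := fun k => by
    have := congrArg (fun q => law q fun a => (a.1 k, a.2.2.2 k, a.2.1.2.1 k)) hslot
    simpa only [law_law] using this
  refine ⟨fun k => ?_, ?_, ?_, ?_, fun k => ?_, fun k => ?_⟩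
  · rw [rateInfo_letterLaw]
    exact ((h.single_rate k).trans_eq (M.rateInfo_letterLaw P k)).trans (hr k)
  · rw [sumInfo_letterLaw]
    exact (h.sum_rate.trans_eq (M.sumInfo_letterLaw P)).trans hs
  · refine h.cut_set.trans_eq ?_
    have h1 := M.condMutualInfo_letterLaw_slot P (fun a => a.1) (fun a => a.2.2.1)
      (fun a => a.2.1.2.2)
    have h2 := M.condMutualInfo_letterLaw_slot P' (fun a => a.1) (fun a => a.2.2.1)
      (fun a => a.2.1.2.2)
    exact h1.trans (hx ▸ h2.symm)
  · have := M.balanceInfo_letterLaw P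
    have := M.balanceInfo_letterLaw P'
    have := h.dependence_balance
    linarith
  · rw [htriple]
    refine (h.sensing_own k).trans (EReal.coe_le_coe_iff.2 ((M.sensing_own_le hP k).trans_eq ?_))
    have h1 := M.condMutualInfo_letterLaw_slot P (fun a => (a.2.1.2.1 k, a.1 (1 - k)))
      (fun a => a.2.2.2 k) (fun a => a.1 k)
    have h2 := M.condMutualInfo_letterLaw_slot P' (fun a => (a.2.1.2.1 k, a.1 (1 - k)))
      (fun a => a.2.2.2 k) (fun a => a.1 k)
    refine (h1.trans (hx ▸ h2.symm)).trans (condMutualInfo_congr _ _ _ fun ω ω' => ?_)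
    simp only [Prod.mk.injEq]
    exact ⟨fun e => ⟨e, Subsingleton.elim _ _⟩, fun e => e.1⟩
  · rw [htriple]
    refine (h.sensing_joint k).trans
      (EReal.coe_le_coe_iff.2 ((M.sensing_joint_le hP k).trans_eq ?_))
    have h1 := M.condMutualInfo_letterLaw_slot P (fun a => a.2.1.2.1 k)
      (fun a => a.2.2.2) (fun a => a.1)
    have h2 := M.condMutualInfo_letterLaw_slot P' (fun a => a.2.1.2.1 k)
      (fun a => a.2.2.2) (fun a => a.1)
    refine (h1.trans (hx ▸ h2.symm)).trans (condMutualInfo_congr _ _ _ fun ω ω' => ?_)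
    simp only [Prod.mk.injEq]
    exact ⟨fun e => ⟨e, Subsingleton.elim _ _⟩, fun e => e.1⟩

/-- The cardinality bound, with a constant `Q`. -/
theorem exists_outerConstraints_card (hP : P ∈ stdSimplex ℝ ((𝒬 × 𝒬Z) × (∀ k, X k))) :
    ∃ P' : (Fin 1 × Fin (Fintype.card (X 0) * Fintype.card (X 1) + 3)) × (∀ k, X k) → ℝ,
      P' ∈ stdSimplex ℝ _ ∧ ∀ R D, M.OuterConstraints P R D → M.OuterConstraints P' R D := by
  classical
  -- A null slice is written as a multiple by zero so that homogeneity makes its informations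
  -- vanish.
  have hzero : ∀ t, ∑ x, P (t, x) = 0 → (fun x => P (t, x)) = fun x => 0 * P (t, x) := by
    intro t ht
    rw [Finset.sum_eq_zero_iff_of_nonneg fun x _ => hP.1 _] at ht
    funext x
    simpa using ht x (Finset.mem_univ x)
  -- The preserved functionals are the input probabilities and three rates; the balance is the one
  -- that may grow. The mass of `t` is the sum of the first functionals, so it is preserved too.
  obtain ⟨s, w, hs, hw, hws, hwa, hwg⟩ := exists_weights_card_support_le
    (ξ := (∀ k, X k) ⊕ Fin 3)
    (fun t => Sum.elim (fun x => P (t, x)) ![M.rateInfo 0 fun x => P (t, x),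
      M.rateInfo 1 fun x => P (t, x), M.sumInfo fun x => P (t, x)])
    (fun t => M.balanceInfo fun x => P (t, x)) (fun t => ∑ x, P (t, x))
    (fun v hv => by
      simp only [Finset.mul_sum]
      rw [Finset.sum_comm]
      exact Finset.sum_eq_zero fun x _ => hv (Sum.inl x))
    (fun t => Finset.sum_nonneg fun x _ => hP.1 _)
    (fun t ht => by
      rw [hzero t ht, rateInfo_const_mul, rateInfo_const_mul, sumInfo_const_mul]
      funext i
      rcases i with x | i
      · simp
      · fin_cases i <;> simp)
    (fun t ht => by rw [hzero t ht, balanceInfo_const_mul, zero_mul])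
  have hcard : Fintype.card ((∀ k, X k) ⊕ Fin 3) =
      Fintype.card (Fin (Fintype.card (X 0) * Fintype.card (X 1) + 3)) := by
    simp [Fintype.card_pi, Fin.prod_univ_two]
  obtain ⟨e⟩ : Nonempty (s ↪ Fin (Fintype.card (X 0) * Fintype.card (X 1) + 3)) :=
    Function.Embedding.nonempty_of_card_le (by rw [Fintype.card_coe, ← hcard]; exact hs)
  -- Unused indices get the zero slice, in the form `0 * 0` to which homogeneity applies.
  set U : Fin (Fintype.card (X 0) * Fintype.card (X 1) + 3) → (∀ k, X k) → ℝ :=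
    Function.extend e (fun t x => w t * P (t, x)) (fun _ x => 0 * 0) with hU
  have hsum : ∀ G : ((∀ k, X k) → ℝ) → ℝ, (∀ c u, G (fun x => c * u x) = c * G u) →
      ∑ t : Fin 1 × Fin (Fintype.card (X 0) * Fintype.card (X 1) + 3), G (U t.2) =
        ∑ t, w t * G fun x => P (t, x) := by
    intro G hG
    have h1 : ∑ t : s, w t * G (fun x => P (t, x)) = ∑ j, G (U j) := by
      refine Finset.sum_of_injOn (e : s → _) e.injective.injOn
        (fun _ _ => Finset.mem_coe.2 (Finset.mem_univ _)) (fun j _ hj => ?_) (fun t _ => ?_)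
      · rw [hU, Function.extend_apply', hG 0 fun _ => 0, zero_mul]
        simpa using hj
      · rw [hU, e.injective.extend_apply, hG]
    rw [Fintype.sum_prod_type, Fintype.sum_unique, ← h1,
      Finset.sum_coe_sort s fun t => w t * G fun x => P (t, x)]
    exact Finset.sum_subset (Finset.subset_univ s) fun t _ ht => by rw [hws t ht, zero_mul]
  have hUx : ∀ x, ∑ t : Fin 1 × Fin (Fintype.card (X 0) * Fintype.card (X 1) + 3), U t.2 x =
      ∑ t, P (t, x) := fun x =>
    (hsum (fun u => u x) fun _ _ => rfl).trans (hwa (Sum.inl x))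
  refine ⟨fun tx => U tx.1.2 tx.2, ⟨fun tx => ?_, ?_⟩, fun R D h => ?_⟩
  · dsimp only
    by_cases hj : ∃ t, e t = tx.1.2
    · obtain ⟨t, ht⟩ := hj
      rw [hU, ← ht, e.injective.extend_apply]
      exact mul_nonneg (hw _) (hP.1 _)
    · rw [hU, Function.extend_apply' _ _ _ hj]
      simp
  · exact (Fintype.sum_prod_type_right _).trans ((Finset.sum_congr rfl fun x _ => hUx x).trans
      ((Fintype.sum_prod_type_right _).symm.trans hP.2))
  · refine h.of_inputLaw_eq hP (funext hUx) (fun k => ?_) ?_ ?_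
    · refine le_of_eq ?_
      rw [hsum (M.rateInfo k) (M.rateInfo_const_mul k)]
      fin_cases k
      · exact (hwa (Sum.inr 0)).symm
      · exact (hwa (Sum.inr 1)).symm
    · rw [hsum M.sumInfo M.sumInfo_const_mul]
      exact (hwa (Sum.inr 2)).ge
    · rw [hsum M.balanceInfo M.balanceInfo_const_mul]
      exact hwg

theorem outerBound_eq_outerBoundCard : M.outerBound = M.outerBoundCard := by
  ext ⟨R, D⟩
  constructor
  · rintro ⟨hR, a, b, P, hP, h⟩
    obtain ⟨P', hP', h'⟩ := M.exists_outerConstraints_card hP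
    exact ⟨hR, 1, _, P', by simp, by simp, hP', h' R D h⟩
  · rintro ⟨hR, a, b, P, _, _, hP, h⟩
    exact ⟨hR, a, b, P, hP, h⟩

end Model

end SingleLetter

/-! ### Continuity of the information measures in the law -/

section Continuity

variable {E Ω α β γ : Type*} [TopologicalSpace E] [Fintype Ω] {p : E → Ω → ℝ}

lemma continuous_law (hp : ∀ ω, Continuous fun y => p y ω) (A : Ω → α) (a : α) :
    Continuous fun y => law (p y) A a := by
  unfold law
  exact continuous_finsetSum _ fun ω _ => hp ω

variable [Fintype α] [Fintype β] [Fintype γ]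

lemma continuous_entropy (hp : ∀ ω, Continuous fun y => p y ω) (A : Ω → α) :
    Continuous fun y => entropy (p y) A := by
  unfold entropy
  exact (continuous_finsetSum _ fun a _ =>
    Real.continuous_negMulLog.comp (continuous_law hp A a)).div_const _

lemma continuous_condEntropy (hp : ∀ ω, Continuous fun y => p y ω) (A : Ω → α) (C : Ω → γ) :
    Continuous fun y => condEntropy (p y) A C :=
  (continuous_entropy hp _).sub (continuous_entropy hp _)

lemma continuous_mutualInfo (hp : ∀ ω, Continuous fun y => p y ω) (A : Ω → α) (B : Ω → β) :
    Continuous fun y => mutualInfo (p y) A B :=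
  (continuous_entropy hp _).sub (continuous_condEntropy hp _ _)

lemma continuous_condMutualInfo (hp : ∀ ω, Continuous fun y => p y ω) (A : Ω → α) (B : Ω → β)
    (C : Ω → γ) : Continuous fun y => condMutualInfo (p y) A B C :=
  (continuous_condEntropy hp _ _).sub (continuous_condEntropy hp _ _)

end Continuity

/-! ### Order properties of the rate-distortion function -/

section RateDistortion

variable {A B E F : Type*} [Fintype A] [Fintype B] [Fintype E] [Fintype F]

lemma rateDistortion_le {d : E → F → ℝ} {P : A × B × E → ℝ} {D c : ℝ}
    {κ : A × B × E → F → ℝ} (hκ : ∀ v, κ v ∈ stdSimplex ℝ F)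
    (hd : ∑ ω, testLaw P κ ω * d ω.1.2.2 ω.2 ≤ D)
    (hc : mutualInfo (testLaw P κ) (fun ω => ω.1.2.2) (fun ω => ω.2) ≤ c) :
    rateDistortion d P D ≤ (c : EReal) := by
  unfold rateDistortion
  exact iInf_le_of_le κ (iInf_le_of_le hκ (iInf_le_of_le hd (EReal.coe_le_coe_iff.2 hc)))

lemma rateDistortion_anti (d : E → F → ℝ) (P : A × B × E → ℝ) {D D' : ℝ} (h : D ≤ D') :
    rateDistortion d P D' ≤ rateDistortion d P D := by
  unfold rateDistortion
  exact iInf_mono fun κ => iInf_mono fun hκ => le_iInf fun hd => iInf_le_of_le (hd.trans h) le_rfl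

/-- The slack `δ` yields a test channel without knowing that the infimum is attained. -/
lemma exists_of_rateDistortion_le {d : E → F → ℝ} {P : A × B × E → ℝ} {D c : ℝ}
    (h : rateDistortion d P D ≤ (c : EReal)) {δ : ℝ} (hδ : 0 < δ) :
    ∃ κ : A × B × E → F → ℝ, (∀ v, κ v ∈ stdSimplex ℝ F) ∧
      ∑ ω, testLaw P κ ω * d ω.1.2.2 ω.2 ≤ D ∧
      mutualInfo (testLaw P κ) (fun ω => ω.1.2.2) (fun ω => ω.2) ≤ c + δ := by
  have h1 : rateDistortion d P D < ((c + δ : ℝ) : EReal) :=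
    h.trans_lt (EReal.coe_lt_coe_iff.2 (by linarith))
  unfold rateDistortion at h1
  simp only [iInf_lt_iff] at h1
  obtain ⟨κ, h2, h3, h4⟩ := h1
  exact ⟨κ, h2, h3, (EReal.coe_lt_coe_iff.1 h4).le⟩

end RateDistortion

/-! ### Removing the slack by compactness -/

section Limit

variable {X Z ST Sh : Fin 2 → Type*} {S SR Y : Type*}
  [∀ k, Fintype (X k)] [∀ k, Fintype (Z k)] [∀ k, Fintype (ST k)] [∀ k, Fintype (Sh k)]
  [Fintype S] [Fintype SR] [Fintype Y] {𝒬 𝒬Z : Type*} [Fintype 𝒬] [Fintype 𝒬Z]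

namespace Model

variable (M : Model X Z ST Sh S SR Y)

variable {M} in
lemma OuterConstraints.mono {P : (𝒬 × 𝒬Z) × (∀ k, X k) → ℝ} {R R' D D' : Fin 2 → ℝ}
    (h : M.OuterConstraints P R D) (hR : ∀ k, R' k ≤ R k) (hD : ∀ k, D k ≤ D' k) :
    M.OuterConstraints P R' D' :=
  ⟨fun k => (hR k).trans (h.single_rate k), (add_le_add (hR 0) (hR 1)).trans h.sum_rate,
    (add_le_add (hR 0) (hR 1)).trans h.cut_set, h.dependence_balance,
    fun k => (rateDistortion_anti _ _ (hD k)).trans (h.sensing_own k),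
    fun k => (rateDistortion_anti _ _ (hD k)).trans (h.sensing_joint k)⟩

/-- For fixed alphabets the constraints of the outer bound are closed. -/
theorem exists_outerConstraints_of_approx {R D : Fin 2 → ℝ}
    (h : ∀ ε > 0, ∃ P ∈ stdSimplex ℝ ((𝒬 × 𝒬Z) × (∀ k, X k)),
      M.OuterConstraints P (fun k => R k - ε) (fun k => D k + ε)) :
    ∃ P ∈ stdSimplex ℝ ((𝒬 × 𝒬Z) × (∀ k, X k)), M.OuterConstraints P R D := by
  have hε : ∀ m : ℕ, (0 : ℝ) < 1 / (m + 1) := fun m => Nat.one_div_pos_of_nat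
  choose P hP hPc using fun m : ℕ => h (1 / (m + 1)) (hε m)
  -- Both sensing constraints bound the same rate-distortion value, so one test channel handles
  -- their minimum. Carrying it along replaces semicontinuity of the rate-distortion function by
  -- compactness of the pairs (law, channels).
  have hκ : ∀ (m : ℕ) (k : Fin 2), ∃ κ : X k × Z k × ST k → Sh k → ℝ,
      (∀ v, κ v ∈ stdSimplex ℝ (Sh k)) ∧
      ∑ ω, testLaw (law (M.letterLaw (P m)) (fun ω => (ω.x k, ω.z k, ω.sT k))) κ ω *
        M.d k ω.1.2.2 ω.2 ≤ D k + 1 / (m + 1) ∧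
      mutualInfo (testLaw (law (M.letterLaw (P m)) (fun ω => (ω.x k, ω.z k, ω.sT k))) κ)
        (fun ω => ω.1.2.2) (fun ω => ω.2) ≤
      min (condMutualInfo (M.letterLaw (P m))
        (fun ω => (ω.sT k, ω.x (1 - k))) (fun ω => ω.z k) (fun ω => (ω.x k, ω.q)))
        (condMutualInfo (M.letterLaw (P m))
        (fun ω => ω.sT k) (fun ω => ω.z) (fun ω => (ω.x, ω.q))) + 1 / (m + 1) := by
    intro m k
    refine exists_of_rateDistortion_le ?_ (hε m)
    rcases min_choice (condMutualInfo (M.letterLaw (P m))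
        (fun ω => (ω.sT k, ω.x (1 - k))) (fun ω => ω.z k) (fun ω => (ω.x k, ω.q)))
        (condMutualInfo (M.letterLaw (P m))
        (fun ω => ω.sT k) (fun ω => ω.z) (fun ω => (ω.x, ω.q))) with h | h
    · rw [h]
      exact (hPc m).sensing_own k
    · rw [h]
      exact (hPc m).sensing_joint k
  choose κ hκ1 hκ2 hκ3 using hκ
  set K : Set (((𝒬 × 𝒬Z) × (∀ k, X k) → ℝ) × (∀ k, X k × Z k × ST k → Sh k → ℝ)) :=
    stdSimplex ℝ ((𝒬 × 𝒬Z) × (∀ k, X k)) ×ˢ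
      Set.pi Set.univ fun k => Set.pi Set.univ fun _ => stdSimplex ℝ (Sh k)
  have hK : IsCompact K := (isCompact_stdSimplex ℝ _).prod
    (isCompact_univ_pi fun k => isCompact_univ_pi fun _ => isCompact_stdSimplex ℝ _)
  obtain ⟨y, hyK, φ, hφ, hlim⟩ := hK.tendsto_subseq (x := fun m => (P m, κ m))
    fun m => ⟨hP m, fun k _ v _ => hκ1 m k v⟩
  have key : ∀ f g : ((𝒬 × 𝒬Z) × (∀ k, X k) → ℝ) × (∀ k, X k × Z k × ST k → Sh k → ℝ) → ℝ,
      Continuous f → Continuous g → ∀ c, (∀ m, f (P m, κ m) ≤ g (P m, κ m) + c * (1 / (m + 1))) →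
      f y ≤ g y := by
    intro f g hf hg c hm
    have h1 : Tendsto (fun m => f (P (φ m), κ (φ m))) atTop (𝓝 (f y)) :=
      (hf.tendsto y).comp hlim
    have h2 : Tendsto (fun m => g (P (φ m), κ (φ m))) atTop (𝓝 (g y)) :=
      (hg.tendsto y).comp hlim
    have h3 : Tendsto (fun m : ℕ => (1 : ℝ) / ((φ m : ℕ) + 1)) atTop (𝓝 0) :=
      tendsto_one_div_add_atTop_nhds_zero_nat.comp hφ.tendsto_atTop
    have h4 := h2.add (h3.const_mul c)
    rw [mul_zero, add_zero] at h4
    exact le_of_tendsto_of_tendsto' h1 h4 fun m => hm (φ m)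
  have hcP : ∀ ω, Continuous fun y : ((𝒬 × 𝒬Z) × (∀ k, X k) → ℝ) × (∀ k, X k × Z k × ST k → Sh k → ℝ) => M.letterLaw y.1 ω := fun ω => by
    unfold letterLaw
    fun_prop
  have hcT : ∀ k ω, Continuous fun y : ((𝒬 × 𝒬Z) × (∀ k, X k) → ℝ) × (∀ k, X k × Z k × ST k → Sh k → ℝ) =>
      testLaw (law (M.letterLaw y.1) (fun ω => (ω.x k, ω.z k, ω.sT k))) (y.2 k) ω := fun k ω => by
    unfold testLaw
    exact (continuous_law hcP _ _).mul (by fun_prop)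
  have hD := fun k => key (fun y => ∑ ω, testLaw (law (M.letterLaw y.1)
      (fun ω => (ω.x k, ω.z k, ω.sT k))) (y.2 k) ω * M.d k ω.1.2.2 ω.2) (fun _ => D k)
      (continuous_finsetSum _ fun ω _ => (hcT k ω).mul continuous_const) continuous_const 1
      fun m => by
        have := hκ2 m k
        linarith
  refine ⟨y.1, hyK.1, fun k => ?_, ?_, ?_, ?_, fun k => ?_, fun k => ?_⟩
  · refine key (fun _ => R k) _ continuous_const (continuous_condMutualInfo hcP
      (fun ω => ω.x k) (fun ω => (ω.y, ω.z)) (fun ω => (ω.sR, ω.x (1 - k), ω.t))) 1 fun m => ?_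
    have := (hPc m).single_rate k
    linarith
  · refine key (fun _ => R 0 + R 1) _ continuous_const (continuous_condMutualInfo hcP
      (fun ω => ω.x) (fun ω => (ω.y, ω.z)) (fun ω => (ω.sR, ω.t))) 2 fun m => ?_
    have := (hPc m).sum_rate
    linarith
  · refine key (fun _ => R 0 + R 1) _ continuous_const (continuous_condMutualInfo hcP
      (fun ω => ω.x) (fun ω => ω.y) (fun ω => ω.sR)) 2 fun m => ?_
    have := (hPc m).cut_set
    linarith
  · refine key _ _ (continuous_condMutualInfo hcP
      (fun ω => ω.x 0) (fun ω => ω.x 1) (fun ω => ω.t)) (continuous_condMutualInfo hcP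
      (fun ω => ω.x 0) (fun ω => ω.x 1) (fun ω => (ω.z, ω.t))) 0 fun m => ?_
    have := (hPc m).dependence_balance
    linarith
  · refine rateDistortion_le (fun v => hyK.2 k trivial v trivial) (hD k) (key _ _
      (continuous_mutualInfo (hcT k) (fun ω => ω.1.2.2) (fun ω => ω.2)) (continuous_condMutualInfo
        hcP (fun ω => (ω.sT k, ω.x (1 - k))) (fun ω => ω.z k) (fun ω => (ω.x k, ω.q))) 1
        fun m => ?_)
    rw [one_mul]
    exact (hκ3 m k).trans (add_le_add (min_le_left _ _) le_rfl)
  · refine rateDistortion_le (fun v => hyK.2 k trivial v trivial) (hD k) (key _ _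
      (continuous_mutualInfo (hcT k) (fun ω => ω.1.2.2) (fun ω => ω.2)) (continuous_condMutualInfo
        hcP (fun ω => ω.sT k) (fun ω => ω.z) (fun ω => (ω.x, ω.q))) 1 fun m => ?_)
    rw [one_mul]
    exact (hκ3 m k).trans (add_le_add (min_le_right _ _) le_rfl)

end Model

end Limit

/-! ### Sequences drawn one entry at a time -/

section Causal

variable {A : Type*} [Fintype A]

/-- The law of a sequence whose entries are drawn successively, given the past. -/
def causalLaw {n : ℕ} (κ : ∀ i : Fin n, (Fin i → A) → A → ℝ) (a : Fin n → A) : ℝ :=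
  ∏ i, κ i (fun j => a (Fin.castLE i.is_lt.le j)) (a i)

omit [Fintype A] in
lemma causalLaw_snoc {n : ℕ} (κ : ∀ i : Fin (n + 1), (Fin i → A) → A → ℝ) (a : Fin n → A) (b : A) :
    causalLaw κ (Fin.snoc (α := fun _ => A) a b) =
      causalLaw (fun i => κ i.castSucc) a * κ (Fin.last n) a b := by
  have h : ∀ (m : ℕ) (hm : m ≤ n) (hm' : m ≤ n + 1), (fun j : Fin m =>
      (Fin.snoc (α := fun _ => A) a b : Fin (n + 1) → A) (Fin.castLE hm' j)) =
      fun j => a (Fin.castLE hm j) := fun m hm hm' => by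
    funext j
    exact Fin.snoc_castSucc (α := fun _ => A) b a (Fin.castLE hm j)
  unfold causalLaw
  rw [Fin.prod_univ_castSucc]
  congr 1
  · refine Finset.prod_congr rfl fun i _ => ?_
    rw [Fin.snoc_castSucc]
    exact congrFun (congrArg (κ i.castSucc) (h i i.is_lt.le _)) _
  · rw [Fin.snoc_last]
    exact congrFun (congrArg (κ (Fin.last n)) (h n le_rfl _)) _

lemma sum_snoc {n : ℕ} (f : (Fin (n + 1) → A) → ℝ) :
    ∑ a, f a = ∑ a : Fin n → A, ∑ b, f (Fin.snoc (α := fun _ => A) a b) := by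
  rw [← (Fin.snocEquiv fun _ => A).sum_comp, Fintype.sum_prod_type_right]
  rfl

lemma sum_causalLaw {n : ℕ} (κ : ∀ i : Fin n, (Fin i → A) → A → ℝ)
    (hκ : ∀ i h, ∑ a, κ i h a = 1) : ∑ a, causalLaw κ a = 1 := by
  induction n with
  | zero => simp [causalLaw]
  | succ n ih =>
    rw [sum_snoc]
    simp only [causalLaw_snoc, ← Finset.mul_sum, hκ, mul_one]
    exact ih _ fun i h => hκ i.castSucc h

-- Delete the last entry repeatedly. Later entries integrate to one because `Φ` ignores them; once
-- entry `i` is the last, summing over it produces its kernel.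
open Classical in
lemma sum_causalLaw_mul {n : ℕ} (κ : ∀ i : Fin n, (Fin i → A) → A → ℝ)
    (hκ : ∀ i h, ∑ a, κ i h a = 1) (i : Fin n) (Φ : (Fin n → A) → ℝ)
    (hΦ : ∀ a a', (∀ j < i, a j = a' j) → Φ a = Φ a') (b : A) :
    ∑ a, causalLaw κ a * (if a i = b then Φ a else 0) =
      ∑ a, causalLaw κ a * (Φ a * κ i (fun j => a (Fin.castLE i.is_lt.le j)) b) := by
  induction n with
  | zero => exact i.elim0
  | succ n ih =>
    set Ψ : (Fin n → A) → ℝ := fun a => Φ (Fin.snoc (α := fun _ => A) a b) with hΨ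
    have hΦΨ : ∀ (a : Fin n → A) (b' : A), Φ (Fin.snoc (α := fun _ => A) a b') = Ψ a := by
      intro a b'
      refine hΦ _ _ fun j hj => ?_
      obtain ⟨j, rfl⟩ := Fin.exists_castSucc_eq.2 (hj.trans_le (Fin.le_last i)).ne
      rw [Fin.snoc_castSucc, Fin.snoc_castSucc]
    rw [sum_snoc, sum_snoc]
    simp only [causalLaw_snoc, hΦΨ]
    induction i using Fin.lastCases with
    | last =>
      refine Finset.sum_congr rfl fun a _ => ?_
      have h : ∀ b', (fun j : Fin n => (Fin.snoc (α := fun _ => A) a b' : Fin (n + 1) → A)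
          (Fin.castLE (Fin.last n).is_lt.le j)) = a := fun b' => by
        funext j
        exact Fin.snoc_castSucc (α := fun _ => A) b' a j
      have h' : ∀ b', κ (Fin.last n) (fun j => (Fin.snoc (α := fun _ => A) a b' : Fin (n + 1) → A)
          (Fin.castLE (Fin.last n).is_lt.le j)) b = κ (Fin.last n) a b := fun b' =>
        congrFun (congrArg (κ (Fin.last n)) (h b')) b
      simp only [Fin.snoc_last, h', mul_ite, mul_zero, Finset.sum_ite_eq', Finset.mem_univ, if_true]
      rw [← Finset.sum_mul, ← Finset.mul_sum, hκ]
      ring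
    | cast i =>
      have h : ∀ (a : Fin n → A) b', (fun j : Fin i =>
          (Fin.snoc (α := fun _ => A) a b' : Fin (n + 1) → A)
          (Fin.castLE i.castSucc.is_lt.le j)) = fun j => a (Fin.castLE i.is_lt.le j) := by
        intro a b'
        funext j
        exact Fin.snoc_castSucc (α := fun _ => A) b' a (Fin.castLE i.is_lt.le j)
      have h' : ∀ (a : Fin n → A) b', κ i.castSucc (fun j =>
          (Fin.snoc (α := fun _ => A) a b' : Fin (n + 1) → A)
          (Fin.castLE i.castSucc.is_lt.le j)) b =
          κ i.castSucc (fun j => a (Fin.castLE i.is_lt.le j)) b := fun a b' =>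
        congrFun (congrArg (κ i.castSucc) (h a b')) b
      simp only [Fin.snoc_castSucc, h', ← Finset.sum_mul, ← Finset.mul_sum, hκ, mul_one]
      refine ih (fun i => κ i.castSucc) (fun i h => hκ i.castSucc h) i Ψ fun a a' haa => ?_
      refine hΦ _ _ fun j hj => ?_
      obtain ⟨j, rfl⟩ := Fin.exists_castSucc_eq.2 (hj.trans_le (Fin.le_last _)).ne
      rw [Fin.snoc_castSucc, Fin.snoc_castSucc]
      exact haa j (Fin.castSucc_lt_castSucc_iff.1 hj)

end Causal

/-! ### Prefixes of sequences, with a type that does not depend on the length -/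

/-- The first `i` entries of a sequence; the others are hidden. -/
def mask {n : ℕ} {B : Type*} (i : ℕ) (f : Fin n → B) (j : Fin n) : Option B :=
  if (j : ℕ) < i then some (f j) else none

lemma mask_eq_iff {n : ℕ} {B : Type*} {i : ℕ} {f g : Fin n → B} :
    mask i f = mask i g ↔ ∀ j : Fin n, (j : ℕ) < i → f j = g j := by
  constructor
  · intro h j hj
    simpa [mask, hj] using congrFun h j
  · intro h
    funext j
    unfold mask
    split_ifs with hj
    · rw [h j hj]
    · rfl

lemma mask_zero {n : ℕ} {B : Type*} (f g : Fin n → B) : mask 0 f = mask 0 g :=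
  mask_eq_iff.2 fun _ h => absurd h (Nat.not_lt_zero _)

lemma mask_succ_eq_iff {n : ℕ} {B : Type*} {i : Fin n} {f g : Fin n → B} :
    mask (i + 1) f = mask (i + 1) g ↔ mask i f = mask i g ∧ f i = g i := by
  simp only [mask_eq_iff]
  constructor
  · exact fun h => ⟨fun j hj => h j (by omega), h i (by omega)⟩
  · rintro ⟨h, h'⟩ j hj
    rcases Nat.lt_succ_iff_lt_or_eq.1 hj with h1 | h1
    · exact h j h1
    · rw [Fin.ext h1, h']

lemma mask_self_eq_iff {n : ℕ} {B : Type*} {f g : Fin n → B} : mask n f = mask n g ↔ f = g := by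
  rw [mask_eq_iff]
  exact ⟨fun h => funext fun j => h j j.is_lt, fun h j _ => by rw [h]⟩

/-! ### Uniform random time and the chain rule -/

section TimeAverage

variable {Ω α β : Type*} [Fintype Ω] [Fintype α] [Fintype β] {n : ℕ}

/-- The joint law of a uniform time index and an independent outcome. -/
def timeAvg (n : ℕ) (p : Ω → ℝ) (x : Fin n × Ω) : ℝ := 1 / (n : ℝ) * p x.2

lemma timeAvg_mem (hn : 0 < n) {p : Ω → ℝ} (hp : p ∈ stdSimplex ℝ Ω) :
    timeAvg n p ∈ stdSimplex ℝ (Fin n × Ω) := by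
  have hn' : (n : ℝ) ≠ 0 := by positivity
  refine ⟨fun x => mul_nonneg (by positivity) (hp.1 _), ?_⟩
  rw [Fintype.sum_prod_type]
  simp [timeAvg, ← Finset.mul_sum, hp.2, hn']

/-- The chain rule for a sequence of random variables `U i` that are successively refined by
`B i`. -/
lemma entropy_sub_entropy_eq_timeAvg (hn : 0 < n) (p : Ω → ℝ) (U : ℕ → Ω → α) (B : Fin n → Ω → β)
    (h : ∀ (i : Fin n) ω ω', U (i + 1) ω = U (i + 1) ω' ↔ U i ω = U i ω' ∧ B i ω = B i ω') :
    entropy p (U n) - entropy p (U 0) =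
      n * condEntropy (timeAvg n p) (fun x => B x.1 x.2) (fun x => (U x.1 x.2, x.1)) := by
  have hn' : (n : ℝ) ≠ 0 := by positivity
  rw [condEntropy_eq_sum_fiber _ _ fun x y hxy => (Prod.ext_iff.1 hxy).2]
  simp only [timeAvg, condEntropy_const_mul, ← Finset.mul_sum]
  -- The entropy difference telescopes, and each increment is the conditional entropy of `B i` given
  -- `U i`.
  rw [← mul_assoc, mul_one_div_cancel hn', one_mul, ← Finset.sum_range_sub (fun i => entropy p (U i)),
    Finset.sum_range]
  refine Finset.sum_congr rfl fun i _ => ?_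
  rw [condEntropy_congr p (B := B i) (D := U i) (fun _ _ => Iff.rfl) fun ω ω' => by simp]
  unfold condEntropy
  congr 1
  refine entropy_congr p fun ω ω' => ?_
  rw [h, Prod.mk.injEq, and_comm]

end TimeAverage

/-! ### The law of a run of the code and its memoryless property -/

section CodeLaw

variable {X Z ST Sh : Fin 2 → Type*} {S SR Y : Type*}
  [∀ k, Fintype (X k)] [∀ k, Fintype (Z k)] [∀ k, Fintype (ST k)] [∀ k, Fintype (Sh k)]
  [Fintype S] [Fintype SR] [Fintype Y] {n : ℕ} {N : Fin 2 → ℕ}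

namespace Code

variable (c : Code X Z Sh SR Y n N) (M : Model X Z ST Sh S SR Y)

omit [∀ k, Fintype (X k)] [∀ k, Fintype (Z k)] [∀ k, Fintype (ST k)] [∀ k, Fintype (Sh k)]
  [Fintype S] [Fintype SR] [Fintype Y] in
lemma input_congr {ω ω' : Run Z ST S SR Y n N} {k : Fin 2} {i : Fin n} (hw : ω.1 k = ω'.1 k)
    (hz : ∀ j : Fin n, (j : ℕ) < i → (ω.2.2 j).2 k = (ω'.2.2 j).2 k) :
    c.input ω k i = c.input ω' k i := by
  unfold input
  rw [hw]
  congr 1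
  funext j
  exact hz _ j.is_lt

/-- The conditional law of the states and outputs at time `i`, given the messages and the past. -/
def stepLaw (w : ∀ k, Fin (N k)) (i : Fin n)
    (h : Fin i → (S × (∀ k, ST k) × SR) × (Y × (∀ k, Z k))) :
    (S × (∀ k, ST k) × SR) × (Y × (∀ k, Z k)) → ℝ :=
  M.kernel fun k => c.enc k i (w k) fun j => (h j).2.2 k

lemma sum_run (f : Run Z ST S SR Y n N → ℝ) :
    ∑ ω, f ω = ∑ w, ∑ a : Fin n → (S × (∀ k, ST k) × SR) × (Y × (∀ k, Z k)),
      f (w, fun i => (a i).1, fun i => (a i).2) := by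
  rw [Fintype.sum_prod_type]
  refine Finset.sum_congr rfl fun w _ => ?_
  exact ((Equiv.arrowProdEquivProdArrow (Fin n) (fun _ => S × (∀ k, ST k) × SR)
    (fun _ => Y × (∀ k, Z k))).sum_comp fun x => f (w, x)).symm

lemma prob_eq (w : ∀ k, Fin (N k)) (a : Fin n → (S × (∀ k, ST k) × SR) × (Y × (∀ k, Z k))) :
    c.prob M (w, fun i => (a i).1, fun i => (a i).2) =
      (∏ k, (1 / (N k : ℝ))) * causalLaw (c.stepLaw M w) a := rfl

lemma sum_stepLaw (w : ∀ k, Fin (N k)) (i : Fin n)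
    (h : Fin i → (S × (∀ k, ST k) × SR) × (Y × (∀ k, Z k))) : ∑ a, c.stepLaw M w i h a = 1 :=
  (M.kernel_mem _).2

lemma prob_nonneg (ω : Run Z ST S SR Y n N) : 0 ≤ c.prob M ω :=
  mul_nonneg (Finset.prod_nonneg fun _ _ => by positivity) (Finset.prod_nonneg fun i _ =>
    mul_nonneg (M.stateLaw_mem.1 _) ((M.channel_mem _ _).1 _))

/-- The messages are independent and uniform. -/
lemma law_messages (w : ∀ k, Fin (N k)) :
    law (c.prob M) (fun ω => ω.1) w = ∏ k, (1 / (N k : ℝ)) := by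
  classical
  rw [law_eq_sum_ite, sum_run]
  simp only [prob_eq]
  rw [Finset.sum_eq_single w]
  · simp only [if_true, ← Finset.mul_sum, sum_causalLaw _ (c.sum_stepLaw M w), mul_one]
  · intro w' _ hw
    simp [hw]
  · simp

lemma prob_mem (hN : ∀ k, 0 < N k) :
    c.prob M ∈ stdSimplex ℝ (Run Z ST S SR Y n N) := by
  refine ⟨c.prob_nonneg M, ?_⟩
  rw [← sum_law _ fun ω => ω.1]
  have h0 : (N 0 : ℝ) ≠ 0 := by exact_mod_cast (hN 0).ne'
  have h1 : (N 1 : ℝ) ≠ 0 := by exact_mod_cast (hN 1).ne'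
  simp only [law_messages, Finset.sum_const, Finset.card_univ, Fintype.card_pi, Fintype.card_fin,
    nsmul_eq_mul, Fin.prod_univ_two, Nat.cast_mul]
  field_simp

/-- The law of the run together with an independent uniform time. -/
def timedProb : Fin n × Run Z ST S SR Y n N → ℝ := timeAvg n (c.prob M)

/-- The inputs at the random time. -/
def timedInput (x : Fin n × Run Z ST S SR Y n N) (k : Fin 2) : X k := c.input x.2 k x.1

/-- The states and outputs at the random time. -/
abbrev timedSlot (x : Fin n × Run Z ST S SR Y n N) :
    (S × (∀ k, ST k) × SR) × (Y × (∀ k, Z k)) := (x.2.2.1 x.1, x.2.2.2 x.1)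

/-- The random time, the messages, and the states and outputs before that time. -/
def timedPast (x : Fin n × Run Z ST S SR Y n N) :
    (Fin n × (∀ k, Fin (N k))) ×
      (Fin n → Option ((S × (∀ k, ST k) × SR) × (Y × (∀ k, Z k)))) :=
  ((x.1, x.2.1), mask x.1 fun j => (x.2.2.1 j, x.2.2.2 j))

/-- The memoryless property: given the messages and the past, the states and outputs at the random
time depend on the inputs only. -/
lemma timedProb_isTransition :
    IsTransition (c.timedProb M) (timedPast (Z := Z) (ST := ST) (S := S) (SR := SR) (Y := Y))
      c.timedInput timedSlot M.kernel := by
  classical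
  intro Φ hΦ a
  rw [Fintype.sum_prod_type, Fintype.sum_prod_type]
  refine Finset.sum_congr rfl fun i _ => ?_
  rw [sum_run, sum_run]
  refine Finset.sum_congr rfl fun w _ => ?_
  simp only [timedProb, timeAvg, prob_eq, mul_assoc]
  rw [← Finset.mul_sum, ← Finset.mul_sum, ← Finset.mul_sum, ← Finset.mul_sum]
  congr 2
  refine sum_causalLaw_mul (c.stepLaw M w) (c.sum_stepLaw M w) i
    (fun a => Φ (i, w, (fun i => (a i).1), fun i => (a i).2)) (fun a a' h => hΦ ?_) a
  unfold timedPast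
  simp only [Prod.mk.injEq, true_and]
  exact mask_eq_iff.2 fun j hj => h j hj

end Code

end CodeLaw

/-! ### Two further information identities and bounds -/

section Information

variable {Ω α β γ δ : Type*} [Fintype Ω] [Fintype α] [Fintype β] [Fintype γ] [Fintype δ]

lemma entropy_le_log_card {p : Ω → ℝ} (hp : p ∈ stdSimplex ℝ Ω) (A : Ω → α) :
    entropy p A ≤ Real.log (Fintype.card α) / Real.log 2 := by
  rw [← condEntropy_const hp]
  refine (condEntropy_le_of_kernel hp.1 (fun _ _ => 1 / (Fintype.card α : ℝ))
    (fun _ _ => by positivity) (fun _ => ?_) fun ω _ => ?_).trans_eq ?_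
  · simp only [Finset.sum_const, Finset.card_univ, nsmul_eq_mul, mul_one_div]
    exact div_self_le_one _
  · have : Nonempty α := ⟨A ω⟩
    have := Fintype.card_pos (α := α)
    positivity
  · rw [← Finset.sum_mul, hp.2]
    simp

/-- This form turns dependence balance into a comparison of conditional entropies of the feedback
`V`, to which the chain rule applies. -/
lemma condMutualInfo_sub_condMutualInfo (p : Ω → ℝ) (A : Ω → α) (B : Ω → β) (V : Ω → γ)
    (T : Ω → δ) :
    condMutualInfo p A B (fun ω => (V ω, T ω)) - condMutualInfo p A B T =
      condEntropy p V (fun ω => (A ω, T ω)) + condEntropy p V (fun ω => (B ω, T ω)) -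
        condEntropy p V (fun ω => ((A ω, B ω), T ω)) - condEntropy p V T := by
  unfold condMutualInfo condEntropy
  rw [entropy_congr p (A := fun ω => (A ω, V ω, T ω)) (B := fun ω => (V ω, A ω, T ω)),
    entropy_congr p (A := fun ω => (B ω, V ω, T ω)) (B := fun ω => (V ω, B ω, T ω)),
    entropy_congr p (A := fun ω => (A ω, B ω, V ω, T ω)) (B := fun ω => (V ω, (A ω, B ω), T ω)),
    entropy_congr p (A := fun ω => (A ω, B ω, T ω)) (B := fun ω => ((A ω, B ω), T ω))]
  · ring
  all_goals
    intro ω ω'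
    simp only [Prod.mk.injEq]
    tauto

end Information

/-! ### Entropy inequalities for a code -/

section Converse

variable {X Z ST Sh : Fin 2 → Type*} {S SR Y : Type*}
  [∀ k, Fintype (X k)] [∀ k, Fintype (Z k)] [∀ k, Fintype (ST k)] [∀ k, Fintype (Sh k)]
  [Fintype S] [Fintype SR] [Fintype Y] {n : ℕ} {N : Fin 2 → ℕ}

/-- The inputs do not influence the states; this is why states at the random time are independent of
the past. -/
lemma law_kernel_state {β : Type*} (M : Model X Z ST Sh S SR Y) (x : ∀ k, X k)
    (g : S × (∀ k, ST k) × SR → β) (b : β) :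
    law (M.kernel x) (fun a => g a.1) b = law M.stateLaw g b := by
  classical
  rw [law_eq_sum_ite, law_eq_sum_ite, Fintype.sum_prod_type]
  refine Finset.sum_congr rfl fun s _ => ?_
  split_ifs
  · simp only [Model.kernel, ← Finset.mul_sum, (M.channel_mem _ _).2, mul_one]
  · simp

namespace Code

variable (c : Code X Z Sh SR Y n N) (M : Model X Z ST Sh S SR Y)

omit [∀ k, Fintype (X k)] [∀ k, Fintype (Z k)] [∀ k, Fintype (ST k)] [∀ k, Fintype (Sh k)]
  [Fintype S] [Fintype SR] [Fintype Y] in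
lemma timedInput_eq {x y : Fin n × Run Z ST S SR Y n N} {k : Fin 2} (h : x.1 = y.1)
    (hw : x.2.1 k = y.2.1 k)
    (hz : ∀ j : Fin n, (j : ℕ) < x.1 → (x.2.2.2 j).2 k = (y.2.2.2 j).2 k) :
    c.timedInput x k = c.timedInput y k := by
  unfold timedInput
  rw [← h]
  exact c.input_congr hw hz

omit [∀ k, Fintype (X k)] [∀ k, Fintype (Z k)] [∀ k, Fintype (ST k)] [∀ k, Fintype (Sh k)]
  [Fintype S] [Fintype SR] [Fintype Y] in
lemma timedPast_eq_iff {x y : Fin n × Run Z ST S SR Y n N} :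
    timedPast x = timedPast y ↔ (x.1 = y.1 ∧ x.2.1 = y.2.1) ∧
      ∀ j : Fin n, (j : ℕ) < x.1 → x.2.2.1 j = y.2.2.1 j ∧ x.2.2.2 j = y.2.2.2 j := by
  unfold timedPast
  rw [Prod.mk.injEq, Prod.mk.injEq]
  refine and_congr_right fun h => ?_
  rw [← h.1, mask_eq_iff]
  simp only [Prod.mk.injEq]

omit [∀ k, Fintype (X k)] [∀ k, Fintype (Z k)] [∀ k, Fintype (ST k)] [∀ k, Fintype (Sh k)]
  [Fintype S] [Fintype SR] [Fintype Y] in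
lemma timedPast_determines_timedInput :
    Determines (timedPast (Z := Z) (ST := ST) (S := S) (SR := SR) (Y := Y)) c.timedInput := by
  intro x y h
  rw [timedPast_eq_iff] at h
  exact funext fun k => c.timedInput_eq h.1.1 (congrFun h.1.2 k) fun j hj => by rw [(h.2 j hj).2]

variable {γ δ ε E : Type*} [Fintype γ] [Fintype δ] [Fintype ε] [Fintype E]

lemma timedProb_mem (hn : 0 < n) (hN : ∀ k, 0 < N k) :
    c.timedProb M ∈ stdSimplex ℝ (Fin n × Run Z ST S SR Y n N) :=
  timeAvg_mem hn (c.prob_mem M hN)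

/-- The states at the random time are independent of the messages and the past. -/
lemma condEntropy_state (hn : 0 < n) (hN : ∀ k, 0 < N k) (g : S × (∀ k, ST k) × SR → γ)
    {V : Fin n × Run Z ST S SR Y n N → δ} (hV : Determines timedPast V) :
    condEntropy (c.timedProb M) (fun x => g (x.2.2.1 x.1)) V =
      entropy (c.timedProb M) (fun x => g (x.2.2.1 x.1)) := by
  rw [← condEntropy_const (c.timedProb_mem M hn hN)]
  exact (c.timedProb_isTransition M).condEntropy_eq (c.timedProb_mem M hn hN).1 (fun a => g a.1) hV
    (fun b _ _ _ => by simp only [law_kernel_state]) (fun _ _ _ => rfl)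
    (fun b _ _ _ => by simp only [law_kernel_state])

/-- Given a state variable and the messages and the past, an output variable depends on the
inputs only. -/
lemma condEntropy_output_timedPast (hn : 0 < n) (hN : ∀ k, 0 < N k)
    (g : S × (∀ k, ST k) × SR → γ) (e : Y × (∀ k, Z k) → E)
    {V : Fin n × Run Z ST S SR Y n N → δ} (hV : Determines timedPast V)
    (hX : Determines V c.timedInput) :
    condEntropy (c.timedProb M) (fun x => e (x.2.2.2 x.1))
        (fun x => (g (x.2.2.1 x.1), timedPast x)) =
      condEntropy (c.timedProb M) (fun x => e (x.2.2.2 x.1)) (fun x => (g (x.2.2.1 x.1), V x)) :=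
  (c.timedProb_isTransition M).condEntropy_pair_eq (c.timedProb_mem M hn hN).1 (fun a => e a.2)
    (fun a => g a.1) (fun _ _ h => h) c.timedPast_determines_timedInput hV hX

/-- Single-letter bound on the information that the receiver's observations `(S_R, e)` carry about
the messages, given the function `C` of the messages. -/
lemma message_info_le (hn : 0 < n) (hN : ∀ k, 0 < N k) (C : (∀ k, Fin (N k)) → γ)
    (e : Y × (∀ k, Z k) → E) (C' : Fin n × Run Z ST S SR Y n N → δ)
    (V : Fin n × Run Z ST S SR Y n N → ε)
    (hC : ∀ x y : Fin n × Run Z ST S SR Y n N, x.1 = y.1 → C x.2.1 = C y.2.1 →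
      (x.2.2.1 x.1).2.2 = (y.2.2.1 y.1).2.2 →
      (∀ j : Fin n, (j : ℕ) < x.1 → e (x.2.2.2 j) = e (y.2.2.2 j)) → C' x = C' y)
    (hV : Determines timedPast V) (hX : Determines V c.timedInput) :
    entropy (c.prob M) (fun ω => ω.1) - entropy (c.prob M) (fun ω => C ω.1) -
      condEntropy (c.prob M) (fun ω => ω.1)
        (fun ω => (C ω.1, fun j => ((ω.2.1 j).2.2, e (ω.2.2 j)))) ≤
    n * (condEntropy (c.timedProb M) (fun x => e (x.2.2.2 x.1)) C' -
      condEntropy (c.timedProb M) (fun x => e (x.2.2.2 x.1))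
        (fun x => ((x.2.2.1 x.1).2.2, V x))) := by
  have hq := (c.timedProb_mem M hn hN).1
  set g : Run Z ST S SR Y n N → Fin n → SR × E := fun ω j => ((ω.2.1 j).2.2, e (ω.2.2 j)) with hg
  -- The information is expanded over time as the entropy of each new observation given `C` and the
  -- past observations, minus the same given all messages.
  set V₁ : Fin n × Run Z ST S SR Y n N → _ := fun x => ((C x.2.1, mask x.1 (g x.2)), x.1) with hV₁
  set V₂ : Fin n × Run Z ST S SR Y n N → _ := fun x => ((x.2.1, mask x.1 (g x.2)), x.1) with hV₂
  have hd : Determines timedPast V₂ := by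
    intro x y h
    rw [timedPast_eq_iff] at h
    simp only [hV₂, Prod.mk.injEq]
    rw [← h.1.1, mask_eq_iff]
    exact ⟨⟨h.1.2, fun j hj => by simp only [hg, h.2 j hj]⟩, rfl⟩
  have hd' : Determines V₂ V₁ := fun x y h => by
    simp only [hV₂, Prod.mk.injEq] at h
    simp only [hV₁, Prod.mk.injEq]
    exact ⟨⟨by rw [h.1.1], h.1.2⟩, h.2⟩
  have h1 := entropy_sub_entropy_eq_timeAvg hn (c.prob M) (fun i ω => (C ω.1, mask i (g ω)))
    (fun i ω => g ω i) fun i ω ω' => by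
      rw [Prod.mk.injEq, Prod.mk.injEq, mask_succ_eq_iff, and_assoc]
  have h2 := entropy_sub_entropy_eq_timeAvg hn (c.prob M) (fun i ω => (ω.1, mask i (g ω)))
    (fun i ω => g ω i) fun i ω ω' => by
      rw [Prod.mk.injEq, Prod.mk.injEq, mask_succ_eq_iff, and_assoc]
  have h3 : condEntropy (c.timedProb M) (fun x => g x.2 x.1) V₁ =
      condEntropy (c.timedProb M) (fun x => (x.2.2.1 x.1).2.2) V₁ +
      condEntropy (c.timedProb M) (fun x => e (x.2.2.2 x.1))
        (fun x => ((x.2.2.1 x.1).2.2, V₁ x)) := condEntropy_pair _ _ _ _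
  have h4 : condEntropy (c.timedProb M) (fun x => g x.2 x.1) V₂ =
      condEntropy (c.timedProb M) (fun x => (x.2.2.1 x.1).2.2) V₂ +
      condEntropy (c.timedProb M) (fun x => e (x.2.2.2 x.1))
        (fun x => ((x.2.2.1 x.1).2.2, V₂ x)) := condEntropy_pair _ _ _ _
  -- The state part of each observation has the same entropy under both conditionings, so it cancels
  -- in the difference.
  have h5 := c.condEntropy_state M hn hN (fun s => s.2.2) hd
  have h6 := c.condEntropy_state M hn hN (fun s => s.2.2) (fun x y h => hd' (hd h))
  have h7 : condEntropy (c.timedProb M) (fun x => e (x.2.2.2 x.1))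
        (fun x => ((x.2.2.1 x.1).2.2, V₁ x)) ≤
      condEntropy (c.timedProb M) (fun x => e (x.2.2.2 x.1)) C' := by
    refine condEntropy_anti hq _ fun x y h => ?_
    simp only [hV₁, Prod.mk.injEq] at h
    obtain ⟨hr, ⟨hc, hm⟩, hi⟩ := h
    rw [← hi, mask_eq_iff] at hm
    exact hC x y hi hc hr fun j hj => (Prod.ext_iff.1 (hm j hj)).2
  -- The full past is the finest conditioning, and by memorylessness it is worth no more than `V`.
  have h8 : condEntropy (c.timedProb M) (fun x => e (x.2.2.2 x.1))
        (fun x => ((x.2.2.1 x.1).2.2, timedPast x)) ≤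
      condEntropy (c.timedProb M) (fun x => e (x.2.2.2 x.1))
        (fun x => ((x.2.2.1 x.1).2.2, V₂ x)) :=
    condEntropy_anti hq _ fun x y h => by
      rw [Prod.mk.injEq] at h
      simp only [h.1, hd h.2]
  have h9 := c.condEntropy_output_timedPast M hn hN (fun s => s.2.2) e hV hX
  have e1 : entropy (c.prob M) (fun ω => (C ω.1, mask n (g ω))) =
      entropy (c.prob M) (fun ω => (C ω.1, g ω)) :=
    entropy_congr _ fun ω ω' => by simp only [Prod.mk.injEq, mask_self_eq_iff]
  have e2 : entropy (c.prob M) (fun ω => (C ω.1, mask 0 (g ω))) =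
      entropy (c.prob M) (fun ω => C ω.1) :=
    entropy_congr _ fun ω ω' => by simp only [Prod.mk.injEq, mask_zero (g ω) (g ω'), and_true]
  have e3 : entropy (c.prob M) (fun ω => (ω.1, mask n (g ω))) =
      entropy (c.prob M) (fun ω => (ω.1, C ω.1, g ω)) :=
    entropy_congr _ fun ω ω' => by
      simp only [Prod.mk.injEq, mask_self_eq_iff]
      exact ⟨fun h => ⟨h.1, by rw [h.1], h.2⟩, fun h => ⟨h.1, h.2.2⟩⟩
  have e4 : entropy (c.prob M) (fun ω => (ω.1, mask 0 (g ω))) =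
      entropy (c.prob M) (fun ω => ω.1) :=
    entropy_congr _ fun ω ω' => by simp only [Prod.mk.injEq, mask_zero (g ω) (g ω'), and_true]
  have h10 : condEntropy (c.timedProb M) (fun x => g x.2 x.1) V₁ -
      condEntropy (c.timedProb M) (fun x => g x.2 x.1) V₂ ≤
      condEntropy (c.timedProb M) (fun x => e (x.2.2.2 x.1)) C' -
      condEntropy (c.timedProb M) (fun x => e (x.2.2.2 x.1))
        (fun x => ((x.2.2.1 x.1).2.2, V x)) := by linarith
  have h11 := mul_le_mul_of_nonneg_left h10 (Nat.cast_nonneg (α := ℝ) n)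
  rw [e1, e2] at h1
  rw [e3, e4] at h2
  change _ = (n : ℝ) * condEntropy (c.timedProb M) (fun x => g x.2 x.1) V₁ at h1
  change _ = (n : ℝ) * condEntropy (c.timedProb M) (fun x => g x.2 x.1) V₂ at h2
  change _ - _ - (entropy (c.prob M) (fun ω => (ω.1, C ω.1, g ω)) -
    entropy (c.prob M) (fun ω => (C ω.1, g ω))) ≤ _
  linarith

lemma entropy_messages (hN : ∀ k, 0 < N k) :
    entropy (c.prob M) (fun ω => ω.1) =
      (Real.log (N 0) + Real.log (N 1)) / Real.log 2 := by
  have h0 : (N 0 : ℝ) ≠ 0 := by exact_mod_cast (hN 0).ne'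
  have h1 : (N 1 : ℝ) ≠ 0 := by exact_mod_cast (hN 1).ne'
  rw [entropy_eq_sum]
  simp only [law_messages]
  rw [← Finset.sum_mul, (c.prob_mem M hN).2, Fin.prod_univ_two, Real.log_mul (one_div_ne_zero h0) (one_div_ne_zero h1),
    one_div, one_div, Real.log_inv, Real.log_inv]
  ring

lemma entropy_message_le (hN : ∀ k, 0 < N k) (k : Fin 2) :
    entropy (c.prob M) (fun ω => ω.1 k) ≤ Real.log (N k) / Real.log 2 := by
  simpa using entropy_le_log_card (c.prob_mem M hN) (fun ω => ω.1 k)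

/-- The residual uncertainty about the messages after decoding. -/
def residual : ℝ := 1 + c.errorProb M * ((Real.log (N 0) + Real.log (N 1)) / Real.log 2)

/-- Fano's inequality for the decoder, whose input is a function of `G`. -/
lemma condEntropy_messages_le (hN : ∀ k, 0 < N k) {G : Run Z ST S SR Y n N → γ}
    (hG : Determines G fun ω => ((fun i => (ω.2.2 i).1), fun i => (ω.2.1 i).2.2)) :
    condEntropy (c.prob M) (fun ω => ω.1) G ≤ c.residual M := by
  have h0 : (N 0 : ℝ) ≠ 0 := by exact_mod_cast (hN 0).ne'
  have h1 : (N 1 : ℝ) ≠ 0 := by exact_mod_cast (hN 1).ne'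
  refine (condEntropy_anti (c.prob_nonneg M) _ hG).trans ((condEntropy_le_of_estimate
    (c.prob_mem M hN) _ _ fun g => c.dec g.1 g.2).trans_eq ?_)
  unfold residual errorProb
  rw [Fintype.card_pi, Fin.prod_univ_two, Fintype.card_fin, Fintype.card_fin, Nat.cast_mul,
    Real.log_mul h0 h1]
  congr!

/-- The single-letter bound on the rates. -/
lemma message_entropy_le (hn : 0 < n) (hN : ∀ k, 0 < N k) (C : (∀ k, Fin (N k)) → γ)
    (e : Y × (∀ k, Z k) → E) (he : Determines e Prod.fst) (C' : Fin n × Run Z ST S SR Y n N → δ)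
    (V : Fin n × Run Z ST S SR Y n N → ε)
    (hC : ∀ x y : Fin n × Run Z ST S SR Y n N, x.1 = y.1 → C x.2.1 = C y.2.1 →
      (x.2.2.1 x.1).2.2 = (y.2.2.1 y.1).2.2 →
      (∀ j : Fin n, (j : ℕ) < x.1 → e (x.2.2.2 j) = e (y.2.2.2 j)) → C' x = C' y)
    (hV : Determines timedPast V) (hX : Determines V c.timedInput) :
    entropy (c.prob M) (fun ω => ω.1) - entropy (c.prob M) (fun ω => C ω.1) - c.residual M ≤
    n * (condEntropy (c.timedProb M) (fun x => e (x.2.2.2 x.1)) C' -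
      condEntropy (c.timedProb M) (fun x => e (x.2.2.2 x.1))
        (fun x => ((x.2.2.1 x.1).2.2, V x))) := by
  have h1 := c.message_info_le M hn hN C e C' V hC hV hX
  have h2 := c.condEntropy_messages_le M hN
    (G := fun ω => (C ω.1, fun j => ((ω.2.1 j).2.2, e (ω.2.2 j)))) fun ω ω' h => by
      have h' := fun j => congrFun (Prod.ext_iff.1 h).2 j
      simp only [Prod.mk.injEq] at h'
      exact Prod.ext (funext fun j => he (h' j).2) (funext fun j => (h' j).1)
  linarith

/-- Dependence balance at the random time. -/
lemma dependence_balance_timed (hn : 0 < n) (hN : ∀ k, 0 < N k) :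
    condMutualInfo (c.timedProb M) (fun x => c.timedInput x 0) (fun x => c.timedInput x 1)
      (fun x => (x.1, mask x.1 fun j => (x.2.2.2 j).2)) ≤
    condMutualInfo (c.timedProb M) (fun x => c.timedInput x 0) (fun x => c.timedInput x 1)
      (fun x => ((x.2.2.2 x.1).2, x.1, mask x.1 fun j => (x.2.2.2 j).2)) := by
  have hq := (c.timedProb_mem M hn hN).1
  have hp := c.prob_nonneg M
  rw [← sub_nonneg, condMutualInfo_sub_condMutualInfo]
  set z : Run Z ST S SR Y n N → Fin n → ∀ k, Z k := fun ω j => (ω.2.2 j).2 with hz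
  set T : Fin n × Run Z ST S SR Y n N → _ := fun x => (x.1, mask x.1 (z x.2)) with hT
  change 0 ≤ condEntropy (c.timedProb M) (fun x => z x.2 x.1) (fun x => (c.timedInput x 0, T x)) +
    condEntropy (c.timedProb M) (fun x => z x.2 x.1) (fun x => (c.timedInput x 1, T x)) -
    condEntropy (c.timedProb M) (fun x => z x.2 x.1)
      (fun x => ((c.timedInput x 0, c.timedInput x 1), T x)) -
    condEntropy (c.timedProb M) (fun x => z x.2 x.1) T
  -- Chain rule for the feedback sequence given a function of the messages; it is used for both
  -- messages, each one alone, and none.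
  have hch : ∀ {α : Type} [Fintype α] (A : (∀ k, Fin (N k)) → α),
      entropy (c.prob M) (fun ω => (A ω.1, z ω)) - entropy (c.prob M) (fun ω => A ω.1) =
      n * condEntropy (c.timedProb M) (fun x => z x.2 x.1)
        (fun x => ((A x.2.1, mask x.1 (z x.2)), x.1)) := by
    intro α _ A
    refine Eq.trans ?_ (entropy_sub_entropy_eq_timeAvg hn (c.prob M)
      (fun i ω => (A ω.1, mask i (z ω))) (fun i ω => z ω i) fun i ω ω' => by
        rw [Prod.mk.injEq, Prod.mk.injEq, mask_succ_eq_iff, and_assoc])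
    congr 1 <;> refine entropy_congr _ fun ω ω' => ?_
    · simp only [Prod.mk.injEq, mask_self_eq_iff]
    · simp only [Prod.mk.injEq, mask_zero (z ω) (z ω'), and_true]
  have hW := hch fun w => w
  have h0 := hch fun w => w 0
  have h1 := hch fun w => w 1
  have hu := hch fun _ => ()
  have hu0 : entropy (c.prob M) (fun _ => ()) = 0 := by
    rw [entropy_eq_sum]
    simp [law, (c.prob_mem M hN).2]
  -- This says I(W_1; W_2 | Z^n) ≥ 0.
  have hsub : entropy (c.prob M) (fun ω => (ω.1, z ω)) + entropy (c.prob M) (fun ω => ((), z ω)) ≤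
      entropy (c.prob M) (fun ω => (ω.1 0, z ω)) + entropy (c.prob M) (fun ω => (ω.1 1, z ω)) := by
    have := condEntropy_pair_le hp (fun ω => ω.1 0) (fun ω => ω.1 1) z
    unfold condEntropy at this
    rw [entropy_congr (c.prob M) (A := fun ω => ((), z ω)) (B := z) fun ω ω' => by simp,
      entropy_congr (c.prob M) (A := fun ω => (ω.1, z ω)) (B := fun ω => (ω.1 0, ω.1 1, z ω))]
    · linarith
    · intro ω ω'
      simp only [Prod.mk.injEq]
      exact ⟨fun h => ⟨congrFun h.1 0, congrFun h.1 1, h.2⟩,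
        fun h => ⟨pair_eq_of_eq 0 h.1 h.2.1, h.2.2⟩⟩
  have hind := c.entropy_messages M hN
  have hm0 := c.entropy_message_le M hN 0
  have hm1 := c.entropy_message_le M hN 1
  rw [add_div] at hind
  -- Message `k` and the past feedback determine input `k`, so they are the finer conditioning.
  have b0 : ∀ k, condEntropy (c.timedProb M) (fun x => z x.2 x.1)
      (fun x => ((x.2.1 k, mask x.1 (z x.2)), x.1)) ≤
      condEntropy (c.timedProb M) (fun x => z x.2 x.1) (fun x => (c.timedInput x k, T x)) := by
    refine fun k => condEntropy_anti hq _ fun x y h => ?_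
    simp only [Prod.mk.injEq] at h
    obtain ⟨⟨hw, hm⟩, hi⟩ := h
    rw [Prod.mk.injEq]
    refine ⟨c.timedInput_eq hi hw fun j hj => ?_, Prod.ext hi hm⟩
    rw [← hi, mask_eq_iff] at hm
    exact congrFun (hm j hj) k
  -- With both inputs known the messages add nothing, so the subtracted term is unchanged.
  have b1 : condEntropy (c.timedProb M) (fun x => z x.2 x.1)
      (fun x => ((c.timedInput x 0, c.timedInput x 1), T x)) =
      condEntropy (c.timedProb M) (fun x => z x.2 x.1)
      (fun x => ((x.2.1, mask x.1 (z x.2)), x.1)) := by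
    refine (c.timedProb_isTransition M).condEntropy_eq hq (fun a => a.2.2) ?_ ?_ ?_ ?_
    · intro x y h
      have hx := c.timedPast_determines_timedInput h
      rw [timedPast_eq_iff] at h
      simp only [hT, Prod.mk.injEq, hx, true_and]
      refine ⟨h.1.1, ?_⟩
      rw [← h.1.1, mask_eq_iff]
      exact fun j hj => by simp only [hz, (h.2 j hj).2]
    · intro b x y h
      simp only [Prod.mk.injEq] at h
      simp only [pair_eq_of_eq 0 h.1.1 h.1.2]
    · intro x y h
      rw [timedPast_eq_iff] at h
      simp only [Prod.mk.injEq]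
      refine ⟨⟨h.1.2, ?_⟩, h.1.1⟩
      rw [← h.1.1, mask_eq_iff]
      exact fun j hj => by simp only [hz, (h.2 j hj).2]
    · intro b x y h
      simp only [Prod.mk.injEq] at h
      obtain ⟨⟨hw, hm⟩, hi⟩ := h
      rw [← hi, mask_eq_iff] at hm
      have : c.timedInput x = c.timedInput y := funext fun k =>
        c.timedInput_eq hi (congrFun hw k) fun j hj => congrFun (hm j hj) k
      simp only [this]
  have b2 : condEntropy (c.timedProb M) (fun x => z x.2 x.1)
      (fun x => (((), mask x.1 (z x.2)), x.1)) =
      condEntropy (c.timedProb M) (fun x => z x.2 x.1) T :=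
    condEntropy_congr _ (fun _ _ => Iff.rfl) fun x y => by
      simp only [hT, Prod.mk.injEq, true_and, and_comm]
  have hn' : (0 : ℝ) < n := Nat.cast_pos.2 hn
  refine nonneg_of_mul_nonneg_right (a := (n : ℝ)) ?_ hn'
  have hb0 := mul_le_mul_of_nonneg_left (b0 0) hn'.le
  have hb1 := mul_le_mul_of_nonneg_left (b0 1) hn'.le
  rw [mul_sub, mul_sub, mul_add, b1, ← b2]
  linarith

/-- Single-letter bound for the estimation of the sensing states from the observations `e` and
the function `C` of the messages. -/
lemma sensing_info_le (hn : 0 < n) (hN : ∀ k, 0 < N k) (k : Fin 2) {η : Type*} [Fintype η]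
    (C : (∀ k, Fin (N k)) → γ) (e : Y × (∀ k, Z k) → E) (est : Fin n → Run Z ST S SR Y n N → η)
    (hest : ∀ i ω ω', C ω.1 = C ω'.1 → (∀ j, e (ω.2.2 j) = e (ω'.2.2 j)) → est i ω = est i ω')
    (C' : Fin n × Run Z ST S SR Y n N → δ) (V : Fin n × Run Z ST S SR Y n N → ε)
    (hC : ∀ x y : Fin n × Run Z ST S SR Y n N, x.1 = y.1 → C x.2.1 = C y.2.1 →
      (∀ j : Fin n, (j : ℕ) < x.1 → e (x.2.2.2 j) = e (y.2.2.2 j)) → C' x = C' y)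
    (hV : Determines timedPast V) (hX : Determines V c.timedInput) :
    mutualInfo (c.timedProb M) (fun x => (x.2.2.1 x.1).2.1 k) (fun x => est x.1 x.2) ≤
      condEntropy (c.timedProb M) (fun x => e (x.2.2.2 x.1)) C' -
      condEntropy (c.timedProb M) (fun x => e (x.2.2.2 x.1))
        (fun x => ((x.2.2.1 x.1).2.1 k, V x)) := by
  have hq := (c.timedProb_mem M hn hN).1
  set s : Run Z ST S SR Y n N → Fin n → ST k := fun ω j => (ω.2.1 j).2.1 k with hs
  set b : Run Z ST S SR Y n N → Fin n → E := fun ω j => e (ω.2.2 j) with hb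
  set sb : Run Z ST S SR Y n N → Fin n → ST k × E := fun ω j => (s ω j, b ω j) with hsb
  -- `V₁` contains the whole observation sequence, hence the estimate, and only the past states.
  -- `V₂` and `V₃` contain the past only.
  set V₁ : Fin n × Run Z ST S SR Y n N → _ :=
    fun x => (((C x.2.1, b x.2), mask x.1 (s x.2)), x.1) with hV₁
  set V₂ : Fin n × Run Z ST S SR Y n N → _ := fun x => ((C x.2.1, mask x.1 (b x.2)), x.1) with hV₂
  set V₃ : Fin n × Run Z ST S SR Y n N → _ := fun x => ((C x.2.1, mask x.1 (sb x.2)), x.1) with hV₃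
  have hd : Determines timedPast V₃ := by
    intro x y h
    rw [timedPast_eq_iff] at h
    simp only [hV₃, Prod.mk.injEq]
    rw [← h.1.1, mask_eq_iff]
    exact ⟨⟨by rw [h.1.2], fun j hj => by simp only [hsb, hs, hb, h.2 j hj]⟩, rfl⟩
  have h1 := entropy_sub_entropy_eq_timeAvg hn (c.prob M)
    (fun i ω => ((C ω.1, b ω), mask i (s ω))) (fun i ω => s ω i) fun i ω ω' => by
      simp only [Prod.mk.injEq, mask_succ_eq_iff, and_assoc]
  have h2 := entropy_sub_entropy_eq_timeAvg hn (c.prob M)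
    (fun i ω => (C ω.1, mask i (b ω))) (fun i ω => b ω i) fun i ω ω' => by
      simp only [Prod.mk.injEq, mask_succ_eq_iff, and_assoc]
  have h3 := entropy_sub_entropy_eq_timeAvg hn (c.prob M)
    (fun i ω => (C ω.1, mask i (sb ω))) (fun i ω => sb ω i) fun i ω ω' => by
      simp only [Prod.mk.injEq, mask_succ_eq_iff, and_assoc]
  change _ = (n : ℝ) * condEntropy (c.timedProb M) (fun x => s x.2 x.1) V₁ at h1
  change _ = (n : ℝ) * condEntropy (c.timedProb M) (fun x => b x.2 x.1) V₂ at h2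
  change _ = (n : ℝ) * condEntropy (c.timedProb M) (fun x => sb x.2 x.1) V₃ at h3
  have e1 : entropy (c.prob M) (fun ω => ((C ω.1, b ω), mask n (s ω))) =
      entropy (c.prob M) (fun ω => (C ω.1, mask n (sb ω))) :=
    entropy_congr _ fun ω ω' => by
      have : sb ω = sb ω' ↔ s ω = s ω' ∧ b ω = b ω' := by
        simp only [hsb, funext_iff, Prod.mk.injEq, forall_and]
      simp only [Prod.mk.injEq, mask_self_eq_iff, this]
      tauto
  have e2 : entropy (c.prob M) (fun ω => ((C ω.1, b ω), mask 0 (s ω))) =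
      entropy (c.prob M) (fun ω => (C ω.1, mask n (b ω))) :=
    entropy_congr _ fun ω ω' => by
      simp only [Prod.mk.injEq, mask_self_eq_iff, mask_zero (s ω) (s ω'), and_true]
  have e3 : entropy (c.prob M) (fun ω => (C ω.1, mask 0 (b ω))) =
      entropy (c.prob M) (fun ω => (C ω.1, mask 0 (sb ω))) :=
    entropy_congr _ fun ω ω' => by
      simp only [Prod.mk.injEq, mask_zero (b ω) (b ω'), mask_zero (sb ω) (sb ω')]
  have h4 : condEntropy (c.timedProb M) (fun x => sb x.2 x.1) V₃ =
      condEntropy (c.timedProb M) (fun x => s x.2 x.1) V₃ +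
      condEntropy (c.timedProb M) (fun x => b x.2 x.1) (fun x => (s x.2 x.1, V₃ x)) :=
    condEntropy_pair _ _ _ _
  have h5 : condEntropy (c.timedProb M) (fun x => s x.2 x.1) V₃ =
      entropy (c.timedProb M) (fun x => s x.2 x.1) :=
    c.condEntropy_state M hn hN (fun s => s.2.1 k) hd
  have h6 : condEntropy (c.timedProb M) (fun x => s x.2 x.1) V₁ ≤
      condEntropy (c.timedProb M) (fun x => s x.2 x.1) (fun x => est x.1 x.2) := by
    refine condEntropy_anti hq _ fun x y h => ?_
    simp only [hV₁, Prod.mk.injEq] at h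
    rw [h.2]
    exact hest _ _ _ h.1.1.1 fun j => congrFun h.1.1.2 j
  have h7 : condEntropy (c.timedProb M) (fun x => b x.2 x.1) V₂ ≤
      condEntropy (c.timedProb M) (fun x => b x.2 x.1) C' := by
    refine condEntropy_anti hq _ fun x y h => ?_
    simp only [hV₂, Prod.mk.injEq] at h
    obtain ⟨⟨hc, hm⟩, hi⟩ := h
    rw [← hi, mask_eq_iff] at hm
    exact hC x y hi hc hm
  have h8 : condEntropy (c.timedProb M) (fun x => b x.2 x.1)
      (fun x => (s x.2 x.1, timedPast x)) ≤
      condEntropy (c.timedProb M) (fun x => b x.2 x.1) (fun x => (s x.2 x.1, V₃ x)) :=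
    condEntropy_anti hq _ fun x y h => by
      rw [Prod.mk.injEq] at h
      simp only [h.1, hd h.2]
  have h9 : condEntropy (c.timedProb M) (fun x => b x.2 x.1)
      (fun x => (s x.2 x.1, timedPast x)) =
      condEntropy (c.timedProb M) (fun x => b x.2 x.1) (fun x => (s x.2 x.1, V x)) :=
    c.condEntropy_output_timedPast M hn hN (fun s => s.2.1 k) e hV hX
  rw [e1, e2] at h1
  rw [e3] at h2
  have hn' : (0 : ℝ) < n := Nat.cast_pos.2 hn
  -- The entropy of states and observations given `C` is expanded in two ways: jointly over time, or
  -- all observations before the states.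
  have h10 : condEntropy (c.timedProb M) (fun x => s x.2 x.1) V₁ =
      condEntropy (c.timedProb M) (fun x => sb x.2 x.1) V₃ -
      condEntropy (c.timedProb M) (fun x => b x.2 x.1) V₂ := by
    refine mul_left_cancel₀ hn'.ne' ?_
    rw [mul_sub]
    linarith
  change entropy (c.timedProb M) (fun x => s x.2 x.1) -
    condEntropy (c.timedProb M) (fun x => s x.2 x.1) (fun x => est x.1 x.2) ≤
    condEntropy (c.timedProb M) (fun x => b x.2 x.1) C' -
    condEntropy (c.timedProb M) (fun x => b x.2 x.1) (fun x => (s x.2 x.1, V x))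
  linarith

end Code

end Converse

/-! ### From codes to the outer bound -/

section Converse

variable {X Z ST Sh : Fin 2 → Type*} {S SR Y : Type*}
  [∀ k, Fintype (X k)] [∀ k, Fintype (Z k)] [∀ k, Fintype (ST k)] [∀ k, Fintype (Sh k)]
  [Fintype S] [Fintype SR] [Fintype Y] {n : ℕ} {N : Fin 2 → ℕ}

namespace Code

variable (c : Code X Z Sh SR Y n N) (M : Model X Z ST Sh S SR Y)

/-- The single-letter outcome at the random time; `Q_Z` consists of the time and the feedback
before that time, and `Q` is constant. -/
def timedLetter (x : Fin n × Run Z ST S SR Y n N) :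
    Letter (Fin 1) (Fin n × (Fin n → Option (∀ k, Z k))) X Z ST S SR Y :=
  (((0, (x.1, mask x.1 fun j => (x.2.2.2 j).2)), c.timedInput x), timedSlot x)

/-- The law of `(T, X_1, X_2)` at the random time. -/
def timedLaw : (Fin 1 × (Fin n × (Fin n → Option (∀ k, Z k)))) × (∀ k, X k) → ℝ :=
  law (c.timedProb M) fun x => (c.timedLetter x).1

omit [∀ k, Fintype (X k)] [∀ k, Fintype (Z k)] [∀ k, Fintype (ST k)] [∀ k, Fintype (Sh k)]
  [Fintype S] [Fintype SR] [Fintype Y] in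
lemma timedPast_determines_timedLetter : Determines
    (timedPast (Z := Z) (ST := ST) (S := S) (SR := SR) (Y := Y)) fun x => (c.timedLetter x).1 := by
  intro x y h
  have hx := c.timedPast_determines_timedInput h
  rw [timedPast_eq_iff] at h
  simp only [timedLetter, Prod.mk.injEq, true_and]
  refine ⟨⟨h.1.1, ?_⟩, hx⟩
  rw [← h.1.1, mask_eq_iff]
  exact fun j hj => by rw [(h.2 j hj).2]

/-- `T` and the inputs are functions of the past, and the rest is drawn from the kernel of the
inputs; pairs (T, X) that never occur have mass zero on both sides. -/
lemma letterLaw_timedLaw :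
    M.letterLaw (c.timedLaw M) = law (c.timedProb M) c.timedLetter := by
  classical
  funext ω
  obtain ⟨t, a⟩ := ω
  rw [Model.letterLaw_eq, timedLaw]
  by_cases hx : ∃ x : Fin n × Run Z ST S SR Y n N, (c.timedLetter x).1 = t
  · obtain ⟨x, rfl⟩ := hx
    have h := (c.timedProb_isTransition M).law_eq (g := fun a => a)
      c.timedPast_determines_timedLetter
      (fun b x y h => by
        have : c.timedInput x = c.timedInput y := congrArg Prod.snd h
        simp only [this]) x a
    have h2 : law (M.kernel (c.timedInput x)) (fun a => a) a = M.kernel (c.timedInput x) a :=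
      law_equiv _ (Equiv.refl _) a
    rw [h2] at h
    refine Eq.trans h.symm (law_congr _ fun y => ?_)
    rw [Prod.mk.injEq, and_comm]
    exact ⟨fun h => Prod.ext h.1 h.2, fun h => Prod.ext_iff.1 h⟩
  · push Not at hx
    rw [law_eq_sum_ite, law_eq_sum_ite, Finset.sum_eq_zero fun x _ => if_neg (hx x),
      Finset.sum_eq_zero fun x _ => if_neg fun h => hx x (congrArg Prod.fst h), zero_mul]

/-- The state estimate at the random time. -/
def timedEstimate (k : Fin 2) (x : Fin n × Run Z ST S SR Y n N) : Sh k :=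
  c.est k (c.input x.2 k) (fun j => (x.2.2.2 j).2 k) x.1

lemma sum_timedProb_mul_d (k : Fin 2) :
    ∑ x, c.timedProb M x * M.d k ((x.2.2.1 x.1).2.1 k) (c.timedEstimate k x) =
      c.distortion M k := by
  rw [Fintype.sum_prod_type, Finset.sum_comm]
  unfold distortion
  refine Finset.sum_congr rfl fun ω _ => ?_
  rw [Finset.mul_sum, Finset.mul_sum]
  refine Finset.sum_congr rfl fun i _ => ?_
  simp only [timedProb, timeAvg, timedEstimate]
  ring

/-- The estimator of the code is a test channel for the rate-distortion function. -/
lemma rateDistortion_timed_le (hn : 0 < n) (hN : ∀ k, 0 < N k) (k : Fin 2) {D b : ℝ}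
    (hD : c.distortion M k ≤ D)
    (hb : mutualInfo (c.timedProb M) (fun x => (x.2.2.1 x.1).2.1 k) (c.timedEstimate k) ≤ b) :
    rateDistortion (M.d k) (law (M.letterLaw (c.timedLaw M)) fun ω => (ω.x k, ω.z k, ω.sT k)) D ≤
      (b : EReal) := by
  rw [letterLaw_timedLaw, law_law]
  set V : Fin n × Run Z ST S SR Y n N → X k × Z k × ST k :=
    fun x => ((c.timedLetter x).x k, (c.timedLetter x).z k, (c.timedLetter x).sT k) with hV
  obtain ⟨κ, hκ, h⟩ := exists_condLaw (c.timedProb_mem M hn hN) V (c.timedEstimate k)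
  have ht : testLaw (law (c.timedProb M) V) κ =
      law (c.timedProb M) fun x => (V x, c.timedEstimate k x) := funext fun ω => h ω.1 ω.2
  refine rateDistortion_le hκ ?_ ?_
  · rw [ht, sum_law_mul]
    exact (c.sum_timedProb_mul_d M k).trans_le hD
  · rw [ht, mutualInfo_law]
    exact hb

omit [∀ k, Fintype (X k)] [∀ k, Fintype (Z k)] [∀ k, Fintype (ST k)] [∀ k, Fintype (Sh k)]
  [Fintype S] [Fintype SR] [Fintype Y] in
lemma timedEstimate_congr (k : Fin 2) (i : Fin n) {ω ω' : Run Z ST S SR Y n N}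
    (hw : ω.1 k = ω'.1 k) (hz : ∀ j, (ω.2.2 j).2 k = (ω'.2.2 j).2 k) :
    c.timedEstimate k (i, ω) = c.timedEstimate k (i, ω') := by
  have h : c.input ω k = c.input ω' k := funext fun i => c.input_congr hw fun j _ => hz j
  simp only [timedEstimate, h, hz]

/-- The single-letter constraints for a code. -/
theorem outerConstraints_timedLaw (hn : 0 < n) (hN : ∀ k, 0 < N k) {R D : Fin 2 → ℝ}
    (hR : ∀ k, n * R k ≤ Real.log (N k) / Real.log 2 - c.residual M)
    (hsum : n * (R 0 + R 1) ≤
      (Real.log (N 0) + Real.log (N 1)) / Real.log 2 - c.residual M)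
    (hD : ∀ k, c.distortion M k ≤ D k) : M.OuterConstraints (c.timedLaw M) R D := by
  have hn' : (0 : ℝ) < n := Nat.cast_pos.2 hn
  have hW := c.entropy_messages M hN
  have hu : entropy (c.prob M) (fun _ => ()) = 0 := by
    rw [entropy_eq_sum]
    simp [law, (c.prob_mem M hN).2]
  set T : Fin n × Run Z ST S SR Y n N → _ := fun x => (c.timedLetter x).t with hT
  have hTd : Determines timedPast T := fun x y h =>
    congrArg Prod.fst (c.timedPast_determines_timedLetter h)
  have hTz : ∀ x y : Fin n × Run Z ST S SR Y n N, x.1 = y.1 →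
      (∀ j : Fin n, (j : ℕ) < x.1 → (x.2.2.2 j).2 = (y.2.2.2 j).2) → T x = T y := by
    intro x y h h'
    simp only [hT, timedLetter, Letter.t, Prod.mk.injEq, true_and]
    refine ⟨h, ?_⟩
    rw [← h, mask_eq_iff]
    exact h'
  have hXd := c.timedPast_determines_timedInput (Z := Z) (ST := ST) (S := S) (SR := SR) (Y := Y)
  refine ⟨fun k => ?_, ?_, ?_, ?_, fun k => ?_, fun k => ?_⟩
  -- Reveal the other message. With past feedback it determines the other input, and at least log
  -- N_k bits remain.
  · rw [letterLaw_timedLaw, condMutualInfo_law, condMutualInfo_eq]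
    have key := c.message_entropy_le M hn hN (fun w => w (1 - k)) (fun o => (o.1, o.2))
      (fun _ _ h => (Prod.ext_iff.1 h).1)
      (fun x => ((x.2.2.1 x.1).2.2, c.timedInput x (1 - k), T x))
      (fun x => (c.timedInput x, T x))
      (fun x y hi hw hr hz => by
        simp only [Prod.mk.injEq] at hz ⊢
        exact ⟨hr, c.timedInput_eq hi hw fun j hj => by rw [(hz j hj).2],
          hTz x y hi fun j hj => (hz j hj).2⟩)
      (fun x y h => by simp only [hXd h, hTd h]) (fun x y h => (Prod.ext_iff.1 h).1)
    rw [condEntropy_congr (c.timedProb M)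
      (C := fun x => ((x.2.2.1 x.1).2.2, c.timedInput x, T x))
      (D := fun x => (c.timedInput x k, (x.2.2.1 x.1).2.2, c.timedInput x (1 - k), T x))
      (fun _ _ => Iff.rfl) fun x y => by
        simp only [Prod.mk.injEq]
        exact ⟨fun h => ⟨congrFun h.2.1 _, h.1, congrFun h.2.1 _, h.2.2⟩,
          fun h => ⟨h.2.1, pair_eq_of_eq k h.1 h.2.2.1, h.2.2.2⟩⟩] at key
    refine le_of_mul_le_mul_left (le_trans ?_ key) hn'
    have h1 := c.entropy_message_le M hN (1 - k)
    have h2 := hR k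
    rw [hW, add_div]
    fin_cases k
    · change entropy (c.prob M) (fun ω => ω.1 1) ≤ Real.log (N 1) / Real.log 2 at h1
      change (n : ℝ) * R 0 ≤ Real.log (N 0) / Real.log 2 - c.residual M at h2
      change (n : ℝ) * R 0 ≤ _ - entropy (c.prob M) (fun ω => ω.1 1) - _
      linarith
    · change entropy (c.prob M) (fun ω => ω.1 0) ≤ Real.log (N 0) / Real.log 2 at h1
      change (n : ℝ) * R 1 ≤ Real.log (N 1) / Real.log 2 - c.residual M at h2
      change (n : ℝ) * R 1 ≤ _ - entropy (c.prob M) (fun ω => ω.1 0) - _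
      linarith
  · rw [letterLaw_timedLaw, condMutualInfo_law, condMutualInfo_eq]
    have key := c.message_entropy_le M hn hN (fun _ => ()) (fun o => (o.1, o.2))
      (fun _ _ h => (Prod.ext_iff.1 h).1)
      (fun x => ((x.2.2.1 x.1).2.2, T x)) (fun x => (c.timedInput x, T x))
      (fun x y hi _ hr hz => by
        simp only [Prod.mk.injEq] at hz ⊢
        exact ⟨hr, hTz x y hi fun j hj => (hz j hj).2⟩)
      (fun x y h => by simp only [hXd h, hTd h]) (fun x y h => (Prod.ext_iff.1 h).1)
    rw [condEntropy_congr (c.timedProb M)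
      (C := fun x => ((x.2.2.1 x.1).2.2, c.timedInput x, T x))
      (D := fun x => (c.timedInput x, (x.2.2.1 x.1).2.2, T x))
      (fun _ _ => Iff.rfl) fun x y => by
        simp only [Prod.mk.injEq]
        tauto] at key
    refine le_of_mul_le_mul_left (le_trans ?_ key) hn'
    rw [hW, hu, sub_zero]
    exact hsum
  -- Here the receiver is not given the feedback, so the past can be dropped and `T` disappears.
  · rw [letterLaw_timedLaw, condMutualInfo_law, condMutualInfo_eq]
    have key := c.message_entropy_le M hn hN (fun _ => ()) (fun o => o.1) (fun _ _ h => h)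
      (fun x => (x.2.2.1 x.1).2.2) c.timedInput (fun x y _ _ hr _ => hr) hXd (fun x y h => h)
    rw [condEntropy_congr (c.timedProb M)
      (C := fun x => ((x.2.2.1 x.1).2.2, c.timedInput x))
      (D := fun x => (c.timedInput x, (x.2.2.1 x.1).2.2))
      (fun _ _ => Iff.rfl) fun x y => by
        simp only [Prod.mk.injEq]
        tauto] at key
    refine le_of_mul_le_mul_left (le_trans ?_ key) hn'
    rw [hW, hu, sub_zero]
    exact hsum
  · rw [letterLaw_timedLaw, condMutualInfo_law, condMutualInfo_law]
    have key := c.dependence_balance_timed M hn hN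
    refine le_of_eq_of_le (condMutualInfo_congr _ _ _ fun x y => ?_)
      (key.trans_eq (condMutualInfo_congr _ _ _ fun x y => ?_))
    · simp only [timedLetter, Letter.t, Prod.mk.injEq, true_and]
    · simp only [timedLetter, Letter.t, Letter.z, timedSlot, Prod.mk.injEq, true_and]
  -- The estimator knows exactly its own message and feedback.
  · refine c.rateDistortion_timed_le M hn hN k (hD k) ?_
    rw [letterLaw_timedLaw, condMutualInfo_law, condMutualInfo_eq]
    have key := c.sensing_info_le M hn hN k (fun w => w k) (fun o => o.2 k)
      (fun i ω => c.timedEstimate k (i, ω)) (fun i ω ω' h h' => c.timedEstimate_congr k i h h')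
      (fun x => c.timedInput x k) c.timedInput (fun x y hi hw hz => c.timedInput_eq hi hw hz)
      hXd (fun x y h => h)
    refine key.trans_eq ?_
    congr 1
    · exact condEntropy_congr _ (fun _ _ => Iff.rfl) fun x y => by
        simp [timedLetter, Letter.x]
    · exact condEntropy_congr _ (fun _ _ => Iff.rfl) fun x y => by
        simp only [timedLetter, Letter.x, Letter.sT, Letter.q, timedSlot, Prod.mk.injEq, and_true]
        exact ⟨fun h => ⟨⟨h.1, congrFun h.2 _⟩, congrFun h.2 _⟩,
          fun h => ⟨h.1.1, pair_eq_of_eq k h.2 h.1.2⟩⟩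
  -- A stronger estimator is allowed: it sees both messages and both feedback sequences.
  · refine c.rateDistortion_timed_le M hn hN k (hD k) ?_
    rw [letterLaw_timedLaw, condMutualInfo_law, condMutualInfo_eq]
    have key := c.sensing_info_le M hn hN k (fun w => w) (fun o => o.2)
      (fun i ω => c.timedEstimate k (i, ω)) (fun i ω ω' h h' =>
        c.timedEstimate_congr k i (congrFun h k) fun j => congrFun (h' j) k)
      c.timedInput c.timedInput (fun x y hi hw hz => funext fun k =>
        c.timedInput_eq hi (congrFun hw k) fun j hj => congrFun (hz j hj) k)
      hXd (fun x y h => h)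
    refine key.trans_eq ?_
    congr 1
    · exact condEntropy_congr _ (fun _ _ => Iff.rfl) fun x y => by
        simp [timedLetter, Letter.x]
    · exact condEntropy_congr _ (fun _ _ => Iff.rfl) fun x y => by
        simp [timedLetter, Letter.x]

lemma errorProb_nonneg : 0 ≤ c.errorProb M :=
  Finset.sum_nonneg fun _ _ => c.prob_nonneg M _

/-- A bound uniform in the block length; without it a bound on the real-valued limsup would not
control the sequence. -/
lemma distortion_le (hN : ∀ k, 0 < N k) (k : Fin 2) :
    c.distortion M k ≤ ∑ s, ∑ ŝ, M.d k s ŝ := by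
  have hd : ∀ s ŝ, M.d k s ŝ ≤ ∑ s, ∑ ŝ, M.d k s ŝ := fun s ŝ =>
    (Finset.single_le_sum (f := fun ŝ => M.d k s ŝ) (fun ŝ _ => M.d_nonneg k s ŝ)
      (Finset.mem_univ ŝ)).trans (Finset.single_le_sum (f := fun s => ∑ ŝ, M.d k s ŝ)
      (fun s _ => Finset.sum_nonneg fun ŝ _ => M.d_nonneg k s ŝ) (Finset.mem_univ s))
  set b := ∑ s, ∑ ŝ, M.d k s ŝ
  have hb : 0 ≤ b := Finset.sum_nonneg fun s _ => Finset.sum_nonneg fun ŝ _ => M.d_nonneg k s ŝ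
  unfold distortion
  refine (Finset.sum_le_sum (g := fun ω => c.prob M ω * b) fun ω _ =>
    mul_le_mul_of_nonneg_left ?_ (c.prob_nonneg M ω)).trans_eq ?_
  · refine (mul_le_mul_of_nonneg_left (Finset.sum_le_sum fun i _ => hd _ _)
      (by positivity)).trans ?_
    rw [Finset.sum_const, Finset.card_univ, Fintype.card_fin, nsmul_eq_mul, ← mul_assoc,
      one_div_mul_eq_div]
    exact mul_le_of_le_one_left hb (div_self_le_one _)
  · rw [← Finset.sum_mul, (c.prob_mem M hN).2, one_mul]

end Code

lemma numMessages_pos {R : ℝ} (hR : 0 ≤ R) (n : ℕ) : 0 < numMessages n R :=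
  Nat.floor_pos.2 (Real.one_le_rpow one_le_two (by positivity))

lemma log_numMessages_le {R : ℝ} (hR : 0 ≤ R) (n : ℕ) :
    Real.log (numMessages n R) / Real.log 2 ≤ n * R := by
  rw [div_le_iff₀ (Real.log_pos one_lt_two), ← Real.log_rpow two_pos]
  exact Real.log_le_log (Nat.cast_pos.2 (numMessages_pos hR n)) (Nat.floor_le (by positivity))

/-- Rounding down a number that is at least 1 loses at most a factor of two, hence one bit. -/
lemma le_log_numMessages {R : ℝ} (hR : 0 ≤ R) (n : ℕ) :
    n * R - 1 ≤ Real.log (numMessages n R) / Real.log 2 := by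
  have hpos : (1 : ℝ) ≤ numMessages n R := by exact_mod_cast numMessages_pos hR n
  have h : (2 : ℝ) ^ ((n : ℝ) * R) ≤ 2 * numMessages n R := by
    have := (Nat.lt_floor_add_one ((2 : ℝ) ^ ((n : ℝ) * R))).le
    unfold numMessages at hpos ⊢
    linarith
  have h2 := Real.log_le_log (by positivity) h
  rw [Real.log_rpow two_pos, Real.log_mul two_ne_zero (by positivity)] at h2
  rw [le_div_iff₀ (Real.log_pos one_lt_two)]
  linarith

namespace Model

variable (M : Model X Z ST Sh S SR Y)

lemma exists_outerConstraints_of_achievable {R D : Fin 2 → ℝ} (h : M.Achievable R D) {ε : ℝ}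
    (hε : 0 < ε) :
    ∃ P ∈ stdSimplex ℝ ((Fin 1 × Fin (Fintype.card (X 0) * Fintype.card (X 1) + 3)) × (∀ k, X k)),
      M.OuterConstraints P (fun k => R k - ε) (fun k => D k + ε) := by
  obtain ⟨hR, c, he, hd⟩ := h
  have hN : ∀ n k, 0 < numMessages n (R k) := fun n k => numMessages_pos (hR k) n
  have hd' : ∀ k, ∀ᶠ n in atTop, (c n).distortion M k < D k + ε := fun k =>
    eventually_lt_of_limsup_lt ((hd k).trans_lt (by linarith))
      (isBoundedUnder_of ⟨_, fun n => (c n).distortion_le M (hN n) k⟩)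
  -- Of the 3 bits, one comes from Fano's inequality and one from rounding each message set.
  have hlim : Tendsto (fun n : ℕ => (c n).errorProb M * (R 0 + R 1) + 3 / (n : ℝ)) atTop (𝓝 0) := by
    have := (he.mul_const (R 0 + R 1)).add (tendsto_const_div_atTop_nhds_zero_nat (3 : ℝ))
    simpa using this
  obtain ⟨n, hn, hn0, hn1, hn2⟩ := ((eventually_gt_atTop 0).and ((hd' 0).and ((hd' 1).and
    (hlim.eventually_lt_const hε)))).exists
  have hn' : (0 : ℝ) < n := Nat.cast_pos.2 hn
  have hle : (c n).residual M ≤ 1 + (c n).errorProb M * (n * R 0 + n * R 1) := by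
    unfold Code.residual
    rw [add_div]
    exact add_le_add le_rfl (mul_le_mul_of_nonneg_left (add_le_add (log_numMessages_le (hR 0) n)
      (log_numMessages_le (hR 1) n)) ((c n).errorProb_nonneg M))
  have hmain : (c n).errorProb M * (n * R 0 + n * R 1) + 3 ≤ n * ε := by
    have := mul_le_mul_of_nonneg_left hn2.le hn'.le
    rw [mul_add, mul_div_cancel₀ _ hn'.ne'] at this
    linarith
  have hC : M.OuterConstraints ((c n).timedLaw M) (fun k => R k - ε) (fun k => D k + ε) := by
    refine (c n).outerConstraints_timedLaw M hn (hN n) (fun k => ?_) ?_ fun k => ?_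
    · have := le_log_numMessages (hR k) n
      rw [mul_sub]
      linarith
    · have := le_log_numMessages (hR 0) n
      have := le_log_numMessages (hR 1) n
      rw [add_div]
      have : (n : ℝ) * (R 0 - ε + (R 1 - ε)) = n * R 0 + n * R 1 - 2 * (n * ε) := by ring
      have := mul_pos hn' hε
      linarith
    · fin_cases k
      · exact hn0.le
      · exact hn1.le
  -- The alphabet of `T` depends on `n` here; the reduction replaces it by one common to all block
  -- lengths, as the limit requires.
  obtain ⟨P, hP, hPC⟩ := M.exists_outerConstraints_card
    (law_mem_stdSimplex ((c n).timedProb_mem M hn (hN n)) fun x => ((c n).timedLetter x).1)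
  exact ⟨P, hP, hPC _ _ hC⟩

/-- The converse: the capacity-distortion region lies in the outer bound. -/
theorem capacityRegion_subset_outerBound {R D : Fin 2 → ℝ} (h : R ∈ M.capacityRegion D) :
    (R, D) ∈ M.outerBound := by
  have hR : ∀ k, 0 ≤ R k := by
    have hcl : IsClosed {R : Fin 2 → ℝ | ∀ k, 0 ≤ R k} := by
      simp only [Set.ofPred_forall]
      exact isClosed_iInter fun k => isClosed_le continuous_const (continuous_apply k)
    exact closure_minimal (fun R' h' => h'.1) hcl h
  obtain ⟨P, hP, hC⟩ := M.exists_outerConstraints_of_approx (𝒬 := Fin 1)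
    (𝒬Z := Fin (Fintype.card (X 0) * Fintype.card (X 1) + 3)) (R := R) (D := D) fun ε hε => by
      obtain ⟨R', hR', hdist⟩ := Metric.mem_closure_iff.1 h (ε / 2) (half_pos hε)
      obtain ⟨P, hP, hC⟩ := M.exists_outerConstraints_of_achievable hR' (half_pos hε)
      have hk : ∀ k, R k - ε ≤ R' k - ε / 2 := fun k => by
        have := (dist_le_pi_dist R R' k).trans hdist.le
        rw [Real.dist_eq] at this
        linarith [le_abs_self (R k - R' k)]
      exact ⟨P, hP, hC.mono hk fun k => by linarith⟩
  exact ⟨hR, 1, _, P, hP, hC⟩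

end Model

end Converse

end ISAC

end


theorem theorem5 {X Z ST Sh : Fin 2 → Type*} {S SR Y : Type*}
    [∀ k, Fintype (X k)] [∀ k, Fintype (Z k)] [∀ k, Fintype (ST k)] [∀ k, Fintype (Sh k)]
    [Fintype S] [Fintype SR] [Fintype Y] (M : ISAC.Model X Z ST Sh S SR Y) :
    (∀ D : Fin 2 → ℝ, ∀ R ∈ M.capacityRegion D, (R, D) ∈ M.outerBound) ∧
      M.outerBound = M.outerBoundCard :=
  ⟨fun _ _ hR => M.capacityRegion_subset_outerBound hR, M.outerBound_eq_outerBoundCard⟩
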